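/- **Setting.** Let $n$ and $m$ be the numbers of states and controls, let $\eta=n+m$, $\chi_k=\begin{bmatrix}x_k\\u_k\end{bmatrix}\in\mathbb R^{\eta}$ and $\Phi_k=\begin{bmatrix}A_k&B_k\\0&I\end{bmatrix}$. For $k\ge 0$ let $H_k$ be a measurement matrix with $\eta$ columns and any number of rows, let $\grave R_k\succ0$, $\tilde R\succ0$, and assume full-state feedback at the current time, $H_0=I_\eta$. Given the current state $\hat x$, the last control $u_{\rm last}$, a horizon $N$ and targets $z_0,\dots,z_N$, the linear-quadratic MPC problem is to minimize over $u_0,\dots,u_N$ $$\sum_{k=0}^{N}\Big(\|z_k-H_k\chi_k\|^2_{\grave R_k^{-1}}+\|u_k-u_{k-1}\|^2_{\tilde R}\Big),\qquad x_{k+1}=A_kx_k+B_ku_k,\quad x_0=\hat x,\quad u_{-1}=u_{\rm last},$$ where $\|v\|_W^2=v^\top Wv$. Put $\grave Q=\begin{bmatrix}0&0\\0&\tilde R^{-1}\end{bmatrix}$, $\Phi_{-1}=I$, and run the Kalman filter: $P_{0(-)}=\grave Q$, $\chi_{0(-)}=\begin{bmatrix}\hat x\\u_{\rm last}\end{bmatrix}$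 and, for $k\ge0$, $$S_k=H_k^\top(H_kP_{k(-)}H_k^\top+\grave R_k)^{-1},\quad K_k=P_{k(-)}S_k,\quad r_k=z_k-H_k\chi_{k(-)},$$ $$\chi_{k+1(-)}=\Phi_k(\chi_{k(-)}+K_kr_k),\quad P_{k+1(-)}=\Phi_k(I-K_kH_k)P_{k(-)}\Phi_k^\top+\grave Q,$$ $$G_{-1}=\begin{bmatrix}O&I\end{bmatrix}P_{0(-)},\qquad G_k=G_{k-1}\Phi_{k-1}^\top(I-K_kH_k)^\top .$$ The observed-control output for horizon $N$ is $u_0=u_{\rm last}+\sum_{k=0}^{N}G_{k-1}\Phi_{k-1}^\top S_kr_k$. In products $\prod_{i=a}^{b}$ factors with larger index stand on the left, and the product is $I$ if $b<a$. Define $$K_{\rm eff}^{[N]}=G_{-1}S_0+\sum_{k=1}^{N}G_{k-1}\Phi_{k-1}^\top S_kH_k\prod_{i=0}^{k-1}\Phi_i(I-K_iH_i),$$ $$\Lambda_0^{[N]}=-\sum_{k=1}^{N}G_{k-1}\Phi_{k-1}^\top S_kH_k\Big(\prod_{i=1}^{k-1}\Phi_i(I-K_iH_i)\Big)\Phi_0,$$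 $$\Lambda_k^{[N]}=G_{k-1}\Phi_{k-1}^\top S_k-\sum_{j=k+1}^{N}G_{j-1}\Phi_{j-1}^\top S_jH_j\Big(\prod_{i=k+1}^{j-1}\Phi_i(I-K_iH_i)\Big)\Phi_kK_k\qquad(1\le k\le N).$$ **Theorem 3.** (a) For all $N\ge 0$, $\hat x$, $u_{\rm last}$ and $z_0,\dots,z_N$, $$u_0=u_{\rm last}+K_{\rm eff}^{[N]}r_0+\sum_{k=0}^{N}\Lambda_k^{[N]}z_k .$$ Moreover the MPC problem has a minimizer, and the first control of every minimizer is $u_0$. (b) Let the data be time-invariant: $A_k=A$ and $B_k=B$ for all $k\ge0$, and $H_k=H$ and $\grave R_k=\grave R$ for all $k\ge1$ (with $H_0=I_\eta$ and $\grave R_0\succ 0$); write $\Phi$ for the constant $\Phi_k$. Assume that $(A,B)$ is stabilizable and $(\Phi,H)$ is detectable. Then, as $N\to\infty$, the gains $K_{\rm eff}^{[N]}$ converge to a matrix $K_\infty$ and, for each $k\ge 0$, $\Lambda_k^{[N]}$ converges to a matrix $\Lambda_k^{\infty}$, and these limits are the optimal reactive and anticipatory gains: for every $\hat x$, every $u_{\rm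 last}$ and every target sequence $(z_k)_{k\ge0}$ with only finitely many nonzero terms, the infinite-horizon problem of minimizing $\sum_{k=0}^{\infty}\big(\|z_k-H_k\chi_k\|^2_{\grave R_k^{-1}}+\|u_k-u_{k-1}\|^2_{\tilde R}\big)$ over control sequences of finite cost has a minimizer, and every minimizer satisfies $u_0=u_{\rm last}+K_\infty r_0+\sum_k\Lambda_k^{\infty}z_k$. (c) In the situation of (b), suppose that the weight at the current time agrees with the later ones up to its state block, that is, $$\grave R_0^{-1}=\begin{bmatrix}Q_0&M\\M^\top&R_{\rm lqr}\end{bmatrix},\qquad H^\top\grave R^{-1}H=\begin{bmatrix}Q&M\\M^\top&R_{\rm lqr}\end{bmatrix}$$ (this holds in particular if $H=I_\eta$ and $\grave R_0=\grave R$). Then $K_\infty$ is the stabilizing LQR gain: it is the unique $K$ such that the feedback $u_k=u_{k-1}-K\begin{bmatrix}x_k\\u_{k-1}\end{bmatrix}$ minimizes $$\sum_{k=0}^{\infty}\big(\|x_k\|_Q^2+\|u_k\|^2_{R_{\rm lqr}}+2x_k^\top Mu_k+\|u_k-u_{k-1}\|^2_{\tilde R}\big)$$ from every initial $(x_0,u_{-1})$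 and all eigenvalues of the closed-loop matrix $\Phi\big(I-\begin{bmatrix}O\\I\end{bmatrix}K\big)$ have modulus less than one. -/

import Mathlib

open Matrix Filter Topology

noncomputable section

namespace ObsCtrl

/-- Index set of the augmented state `χ = (x, u)` with `n` states and `m` controls. -/
abbrev AugIdx (n m : ℕ) : Type := Fin n ⊕ Fin m

/-- Index set of the target (measurement) `z_k`.  At the current time `k = 0` it has the size of
the augmented state, so that `H_0 = I` makes sense; at `k ≥ 1` it has an arbitrary size `p k`. -/
def MeasIdx (n m : ℕ) (p : ℕ → ℕ) : ℕ → Type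
  | 0 => AugIdx n m
  | k + 1 => Fin (p (k + 1))

instance instFintypeMeasIdx (n m : ℕ) (p : ℕ → ℕ) : (k : ℕ) → Fintype (MeasIdx n m p k)
  | 0 => inferInstanceAs (Fintype (AugIdx n m))
  | k + 1 => inferInstanceAs (Fintype (Fin (p (k + 1))))

instance instDecidableEqMeasIdx (n m : ℕ) (p : ℕ → ℕ) :
    (k : ℕ) → DecidableEq (MeasIdx n m p k)
  | 0 => inferInstanceAs (DecidableEq (AugIdx n m))
  | k + 1 => inferInstanceAs (DecidableEq (Fin (p (k + 1))))

/-- The quadratic form `‖v‖²_W = vᵀ W v`. -/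
def quad {ι : Type} [Fintype ι] (W : Matrix ι ι ℝ) (v : ι → ℝ) : ℝ := v ⬝ᵥ (W *ᵥ v)

/-- The augmented transition matrix `[A B; 0 I]`. -/
def augPhi {n m : ℕ} (A : Matrix (Fin n) (Fin n) ℝ) (B : Matrix (Fin n) (Fin m) ℝ) :
    Matrix (AugIdx n m) (AugIdx n m) ℝ :=
  Matrix.fromBlocks A B 0 1

/-- The selection matrix `[O I]`, of size `m × (n + m)`. -/
def ctrlSel (n m : ℕ) : Matrix (Fin m) (AugIdx n m) ℝ := Matrix.fromCols 0 1

/-- The ordered product `F_{b-1} ⋯ F_{a+1} F_a` over `a ≤ i < b`, later factors on the left; it is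
the identity when `b ≤ a`. -/
def prodIco {ι : Type} [Fintype ι] [DecidableEq ι] (F : ℕ → Matrix ι ι ℝ) (a : ℕ) :
    ℕ → Matrix ι ι ℝ
  | 0 => 1
  | b + 1 => if a ≤ b then F b * prodIco F a b else 1

/-- The previous control `u_{k-1}`, where `u_{-1}` is the control `uLast` applied last. -/
def prevCtrl {m : ℕ} (uLast : Fin m → ℝ) (u : ℕ → Fin m → ℝ) : ℕ → Fin m → ℝ
  | 0 => uLast
  | k + 1 => u k

/-- The state `x_k` of the plant `x_{k+1} = A_k x_k + B_k u_k` started at `x0`. -/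
def plantState {n m : ℕ} (A : ℕ → Matrix (Fin n) (Fin n) ℝ) (B : ℕ → Matrix (Fin n) (Fin m) ℝ)
    (x0 : Fin n → ℝ) (u : ℕ → Fin m → ℝ) : ℕ → Fin n → ℝ
  | 0 => x0
  | k + 1 => A k *ᵥ plantState A B x0 u k + B k *ᵥ u k

/-- Data of a linear-quadratic predictive control problem: dynamics `A_k, B_k`, sensitivities `H_k`,
measurement covariances `R_k` (whose inverses are the tracking weights) and the weight `Rt` on the
control rate `u_k - u_{k-1}`. -/
structure LQMPC (n m : ℕ) (p : ℕ → ℕ) where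
  A : ℕ → Matrix (Fin n) (Fin n) ℝ
  B : ℕ → Matrix (Fin n) (Fin m) ℝ
  H : (k : ℕ) → Matrix (MeasIdx n m p k) (AugIdx n m) ℝ
  R : (k : ℕ) → Matrix (MeasIdx n m p k) (MeasIdx n m p k) ℝ
  Rt : Matrix (Fin m) (Fin m) ℝ

namespace LQMPC

variable {n m : ℕ} {p : ℕ → ℕ}

/-! ### The predictive control problem -/

/-- The stage cost `‖z_k - H_k χ_k‖²_{R_k⁻¹} + ‖u_k - u_{k-1}‖²_{Rt}` with `χ_k = (x_k, u_k)`. -/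
def stage (D : LQMPC n m p) (x0 : Fin n → ℝ) (uLast : Fin m → ℝ)
    (z : (k : ℕ) → MeasIdx n m p k → ℝ) (u : ℕ → Fin m → ℝ) (k : ℕ) : ℝ :=
  quad (D.R k)⁻¹ (z k - D.H k *ᵥ Sum.elim (plantState D.A D.B x0 u k) (u k))
    + quad D.Rt (u k - prevCtrl uLast u k)

/-- `u` (of which only `u_0, …, u_N` matter) minimizes the cost over the horizon `0, …, N`. -/
def IsOptimal (D : LQMPC n m p) (x0 : Fin n → ℝ) (uLast : Fin m → ℝ)
    (z : (k : ℕ) → MeasIdx n m p k → ℝ) (N : ℕ) (u : ℕ → Fin m → ℝ) : Prop :=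
  ∀ w : ℕ → Fin m → ℝ,
    ∑ k ∈ Finset.range (N + 1), D.stage x0 uLast z u k
      ≤ ∑ k ∈ Finset.range (N + 1), D.stage x0 uLast z w k

/-- `u` has finite infinite-horizon cost, and no control sequence of finite cost does better. -/
def IsOptimalInf (D : LQMPC n m p) (x0 : Fin n → ℝ) (uLast : Fin m → ℝ)
    (z : (k : ℕ) → MeasIdx n m p k → ℝ) (u : ℕ → Fin m → ℝ) : Prop :=
  Summable (D.stage x0 uLast z u) ∧
    ∀ w : ℕ → Fin m → ℝ, Summable (D.stage x0 uLast z w) →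
      ∑' k, D.stage x0 uLast z u k ≤ ∑' k, D.stage x0 uLast z w k

/-! ### The filter -/

/-- `Φ_k`. -/
def Phi (D : LQMPC n m p) (k : ℕ) : Matrix (AugIdx n m) (AugIdx n m) ℝ := augPhi (D.A k) (D.B k)

/-- `Φ_{k-1}`, with `Φ_{-1} = I`. -/
def PhiPrev (D : LQMPC n m p) : ℕ → Matrix (AugIdx n m) (AugIdx n m) ℝ
  | 0 => 1
  | k + 1 => D.Phi k

/-- The process covariance `[O 0; 0 Rt⁻¹]`. -/
def Qc (D : LQMPC n m p) : Matrix (AugIdx n m) (AugIdx n m) ℝ := Matrix.fromBlocks 0 0 0 D.Rt⁻¹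

/-- `Hᵀ (H P Hᵀ + R)⁻¹` at time `k` for the prior covariance `P`. -/
def Smat (D : LQMPC n m p) (k : ℕ) (P : Matrix (AugIdx n m) (AugIdx n m) ℝ) :
    Matrix (AugIdx n m) (MeasIdx n m p k) ℝ :=
  (D.H k)ᵀ * (D.H k * P * (D.H k)ᵀ + D.R k)⁻¹

/-- The prior covariances: `P_{0(-)} = Qc` and `P_{k+1(-)} = Φ_k (I - K_k H_k) P_{k(-)} Φ_kᵀ + Qc`,
where `K_k = P_{k(-)} S_k`. -/
def P (D : LQMPC n m p) : ℕ → Matrix (AugIdx n m) (AugIdx n m) ℝ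
  | 0 => D.Qc
  | k + 1 =>
      D.Phi k * ((1 - D.P k * D.Smat k (D.P k) * D.H k) * D.P k) * (D.Phi k)ᵀ + D.Qc

/-- `S_k = H_kᵀ (H_k P_{k(-)} H_kᵀ + R_k)⁻¹`. -/
def S (D : LQMPC n m p) (k : ℕ) : Matrix (AugIdx n m) (MeasIdx n m p k) ℝ := D.Smat k (D.P k)

/-- The Kalman gain `K_k = P_{k(-)} S_k`. -/
def K (D : LQMPC n m p) (k : ℕ) : Matrix (AugIdx n m) (MeasIdx n m p k) ℝ := D.P k * D.S k

/-- `G_{k-1}`: `G_{-1} = [O I] P_{0(-)}` and `G_k = G_{k-1} Φ_{k-1}ᵀ (I - K_k H_k)ᵀ`. -/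
def GPrev (D : LQMPC n m p) : ℕ → Matrix (Fin m) (AugIdx n m) ℝ
  | 0 => ctrlSel n m * D.P 0
  | k + 1 => D.GPrev k * (D.PhiPrev k)ᵀ * (1 - D.K k * D.H k)ᵀ

/-- The prior means: `χ_{0(-)} = (x0, uLast)`, `χ_{k+1(-)} = Φ_k (χ_{k(-)} + K_k r_k)`, where
`r_k = z_k - H_k χ_{k(-)}`. -/
def prior (D : LQMPC n m p) (x0 : Fin n → ℝ) (uLast : Fin m → ℝ)
    (z : (k : ℕ) → MeasIdx n m p k → ℝ) : ℕ → AugIdx n m → ℝ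
  | 0 => Sum.elim x0 uLast
  | k + 1 =>
      D.Phi k *ᵥ (D.prior x0 uLast z k + D.K k *ᵥ (z k - D.H k *ᵥ D.prior x0 uLast z k))

/-- The residual `r_k = z_k - H_k χ_{k(-)}`. -/
def residual (D : LQMPC n m p) (x0 : Fin n → ℝ) (uLast : Fin m → ℝ)
    (z : (k : ℕ) → MeasIdx n m p k → ℝ) (k : ℕ) : MeasIdx n m p k → ℝ :=
  z k - D.H k *ᵥ D.prior x0 uLast z k

/-- The observed-control output `u_0` for horizon length `N`: starting from `uLast`, every
`k = 0, …, N` of the forward pass adds `G_{k-1} Φ_{k-1}ᵀ S_k r_k`. -/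
def output (D : LQMPC n m p) (x0 : Fin n → ℝ) (uLast : Fin m → ℝ)
    (z : (k : ℕ) → MeasIdx n m p k → ℝ) (N : ℕ) : Fin m → ℝ :=
  uLast + ∑ k ∈ Finset.range (N + 1),
    (D.GPrev k * (D.PhiPrev k)ᵀ * D.S k) *ᵥ D.residual x0 uLast z k

/-! ### The reactive and the anticipatory gains -/

/-- `Φ_i (I - K_i H_i)`. -/
def step (D : LQMPC n m p) (i : ℕ) : Matrix (AugIdx n m) (AugIdx n m) ℝ :=
  D.Phi i * (1 - D.K i * D.H i)

/-- The reactive gain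
`G_{-1} S_0 + ∑_{k=1}^N G_{k-1} Φ_{k-1}ᵀ S_k H_k ∏_{i=0}^{k-1} Φ_i (I - K_i H_i)`. -/
def Keff (D : LQMPC n m p) (N : ℕ) : Matrix (Fin m) (AugIdx n m) ℝ :=
  let first : Matrix (Fin m) (AugIdx n m) ℝ := D.GPrev 0 * D.S 0
  first + ∑ k ∈ Finset.Icc 1 N,
    D.GPrev k * (D.PhiPrev k)ᵀ * D.S k * D.H k * prodIco D.step 0 k

/-- The feed-forward gains: `Λ_0 = -∑_{k=1}^N G_{k-1} Φ_{k-1}ᵀ S_k H_k (∏_{i=1}^{k-1} Φ_i (I - K_i H_i)) Φ_0`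
and, for `1 ≤ k ≤ N`, `Λ_k = G_{k-1} Φ_{k-1}ᵀ S_k
  - ∑_{j=k+1}^N G_{j-1} Φ_{j-1}ᵀ S_j H_j (∏_{i=k+1}^{j-1} Φ_i (I - K_i H_i)) Φ_k K_k`. -/
def Lam (D : LQMPC n m p) (N : ℕ) : (k : ℕ) → Matrix (Fin m) (MeasIdx n m p k) ℝ
  | 0 =>
      let L : Matrix (Fin m) (AugIdx n m) ℝ := -∑ k ∈ Finset.Icc 1 N,
        D.GPrev k * (D.PhiPrev k)ᵀ * D.S k * D.H k * prodIco D.step 1 k * D.Phi 0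
      L
  | k + 1 =>
      D.GPrev (k + 1) * (D.PhiPrev (k + 1))ᵀ * D.S (k + 1)
        - ∑ j ∈ Finset.Icc (k + 2) N,
            D.GPrev j * (D.PhiPrev j)ᵀ * D.S j * D.H j * prodIco D.step (k + 2) j
              * D.Phi (k + 1) * D.K (k + 1)

end LQMPC

/-- Time-invariant data: constant dynamics, full-state feedback `H_0 = I` with covariance `R0` at the
current time, and constant `H`, `R` at all later times. -/
def ltiData {n m q : ℕ} (A : Matrix (Fin n) (Fin n) ℝ) (B : Matrix (Fin n) (Fin m) ℝ)
    (R0 : Matrix (AugIdx n m) (AugIdx n m) ℝ) (H : Matrix (Fin q) (AugIdx n m) ℝ)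
    (R : Matrix (Fin q) (Fin q) ℝ) (Rt : Matrix (Fin m) (Fin m) ℝ) :
    LQMPC n m (fun _ => q) where
  A := fun _ => A
  B := fun _ => B
  H := fun k => match k with
    | 0 => (1 : Matrix (AugIdx n m) (AugIdx n m) ℝ)
    | _ + 1 => H
  R := fun k => match k with
    | 0 => R0
    | _ + 1 => R
  Rt := Rt

/-- All complex eigenvalues have modulus less than one. -/
def IsSchur {ι : Type} [Fintype ι] [DecidableEq ι] (F : Matrix ι ι ℝ) : Prop :=
  ∀ l ∈ spectrum ℂ (F.map (algebraMap ℝ ℂ)), ‖l‖ < 1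

/-- The pair `(A, B)` is stabilizable. -/
def Stabilizable {ι κ : Type} [Fintype ι] [DecidableEq ι] [Fintype κ]
    (A : Matrix ι ι ℝ) (B : Matrix ι κ ℝ) : Prop :=
  ∃ F : Matrix κ ι ℝ, IsSchur (A - B * F)

/-- The pair `(A, C)` is detectable. -/
def Detectable {ι κ : Type} [Fintype ι] [DecidableEq ι] [Fintype κ]
    (A : Matrix ι ι ℝ) (C : Matrix κ ι ℝ) : Prop :=
  ∃ L : Matrix ι κ ℝ, IsSchur (A - L * C)

/-! ### The infinite-horizon linear quadratic regulator -/

section LQR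

variable {n m : ℕ} (A : Matrix (Fin n) (Fin n) ℝ) (B : Matrix (Fin n) (Fin m) ℝ)
  (Q : Matrix (Fin n) (Fin n) ℝ) (M : Matrix (Fin n) (Fin m) ℝ) (Rl Rt : Matrix (Fin m) (Fin m) ℝ)

/-- The stage cost `‖x_k‖²_Q + ‖u_k‖²_{Rl} + 2 x_kᵀ M u_k + ‖u_k - u_{k-1}‖²_{Rt}`. -/
def lqrStage (x0 : Fin n → ℝ) (uLast : Fin m → ℝ) (u : ℕ → Fin m → ℝ) (k : ℕ) : ℝ :=
  let x := plantState (fun _ => A) (fun _ => B) x0 u k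
  quad Q x + quad Rl (u k) + 2 * (x ⬝ᵥ (M *ᵥ u k)) + quad Rt (u k - prevCtrl uLast u k)

/-- `u` has finite regulator cost, and no control sequence of finite cost does better. -/
def IsLQROptimal (x0 : Fin n → ℝ) (uLast : Fin m → ℝ) (u : ℕ → Fin m → ℝ) : Prop :=
  Summable (lqrStage A B Q M Rl Rt x0 uLast u) ∧
    ∀ w : ℕ → Fin m → ℝ, Summable (lqrStage A B Q M Rl Rt x0 uLast w) →
      ∑' k, lqrStage A B Q M Rl Rt x0 uLast u k ≤ ∑' k, lqrStage A B Q M Rl Rt x0 uLast w k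

/-- `K` is a stabilizing LQR gain: the state feedback `u_k = u_{k-1} - K (x_k, u_{k-1})` solves the
regulator problem from every initial `(x_0, u_{-1})`, and its closed loop, which maps
`(x_k, u_{k-1})` to `(x_{k+1}, u_k)`, is asymptotically stable. -/
def IsStabilizingLQRGain (K : Matrix (Fin m) (AugIdx n m) ℝ) : Prop :=
  (∀ (x0 : Fin n → ℝ) (uLast : Fin m → ℝ) (u : ℕ → Fin m → ℝ),
    (∀ k, u k = prevCtrl uLast u k
      - K *ᵥ Sum.elim (plantState (fun _ => A) (fun _ => B) x0 u k) (prevCtrl uLast u k)) →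
    IsLQROptimal A B Q M Rl Rt x0 uLast u) ∧
  IsSchur (augPhi A B * (1 - (ctrlSel n m)ᵀ * K))

end LQR

end ObsCtrl

end

/-! The predictive control problem is a least-squares smoothing problem in which the process noise
is the control increment `u_k - u_{k-1}` of covariance `Rt⁻¹`. The Kalman filter solves it forwards,
and a costate recursion `l_k = S_k r_k + (Φ_k (I - K_k H_k))ᵀ l_{k+1}` with `l_{N+1} = 0` turns the
prior means into the smoothed trajectory `χ_{k(-)} + P_{k(-)} l_k`. That trajectory obeys the plant,
and `smoothed_residual` shows that the costate is its adjoint variable. By convexity the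
stationarity conditions are sufficient (`isOptimal_of_adjoint`), and the first control of a
minimizer is unique because `Rt` is positive definite. Unrolling the costate at time `0` against the
matrices `G` gives the output. Since `H_0 = I`, the initial data equal `z_0 - r_0`, so each prior
mean after time `0` is linear in `r_0` and the targets; induction on the horizon yields the gains.

The limits need no Riccati analysis. The optimal values increase with `N` and are bounded, since
stabilizability provides a control of finite cost. Strong convexity in the increments then makes the
minimizers Cauchy at each time, and their limit is optimal for the infinite horizon
(`exists_isOptimalInf`). Special data isolate each gain in the output, so the gains converge too.

With zero targets the problem is the regulator problem up to a constant. The principle of optimality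
turns every minimizer into the feedback with gain `K_∞`; its finite cost and detectability force the
state to zero, which is Schur stability. -/

noncomputable section
namespace ObsCtrl

/-! ### Quadratic forms. -/

section Quad
variable {ι κ : Type} [Fintype ι] [Fintype κ]

lemma quad_nonneg {W : Matrix ι ι ℝ} (hW : W.PosSemidef) (v : ι → ℝ) : 0 ≤ quad W v := by
  simpa [quad] using hW.dotProduct_mulVec_nonneg v

lemma quad_pos {W : Matrix ι ι ℝ} (hW : W.PosDef) {v : ι → ℝ} (hv : v ≠ 0) : 0 < quad W v := by
  simpa [quad] using hW.dotProduct_mulVec_pos hv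

@[simp] lemma quad_zero (W : Matrix ι ι ℝ) : quad W 0 = 0 := by simp [quad]

lemma quad_smul (W : Matrix ι ι ℝ) (c : ℝ) (v : ι → ℝ) : quad W (c • v) = c ^ 2 * quad W v := by
  simp only [quad, mulVec_smul, smul_dotProduct, dotProduct_smul, smul_eq_mul]; ring

lemma quad_neg (W : Matrix ι ι ℝ) (v : ι → ℝ) : quad W (-v) = quad W v := by
  simp [quad, mulVec_neg]

lemma dotProduct_mulVec_comm {W : Matrix ι ι ℝ} (hW : Wᵀ = W) (a b : ι → ℝ) :
    b ⬝ᵥ (W *ᵥ a) = a ⬝ᵥ (W *ᵥ b) := by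
  rw [dotProduct_mulVec, ← mulVec_transpose, hW, dotProduct_comm]

lemma quad_add {W : Matrix ι ι ℝ} (hW : Wᵀ = W) (a b : ι → ℝ) :
    quad W (a + b) = quad W a + 2 * (b ⬝ᵥ (W *ᵥ a)) + quad W b := by
  have := dotProduct_mulVec_comm hW a b
  simp only [quad, mulVec_add, add_dotProduct, dotProduct_add]
  linarith

/-- The parallelogram law; the term in `a - b` is the source of all strong convexity below. -/
lemma quad_midpoint (W : Matrix ι ι ℝ) (a b : ι → ℝ) :
    quad W ((1 / 2 : ℝ) • (a + b)) + (1 / 4) * quad W (a - b) = (quad W a + quad W b) / 2 := by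
  simp only [quad, mulVec_smul, smul_dotProduct, dotProduct_smul, smul_eq_mul, mulVec_add,
    add_dotProduct, dotProduct_add, mulVec_sub, sub_dotProduct, dotProduct_sub]
  ring

lemma quad_mulVec (W : Matrix ι ι ℝ) (H : Matrix ι κ ℝ) (v : κ → ℝ) :
    quad W (H *ᵥ v) = quad (Hᵀ * W * H) v := by
  simp only [quad, ← mulVec_mulVec]
  rw [dotProduct_mulVec v Hᵀ, vecMul_transpose]

lemma continuous_quad (W : Matrix ι ι ℝ) : Continuous (quad W) := by
  unfold quad; fun_prop

/-- A positive definite form dominates a multiple of the squared norm. -/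
lemma exists_sq_norm_le_quad {W : Matrix ι ι ℝ} (hW : W.PosDef) :
    ∃ c : ℝ, 0 < c ∧ ∀ v : ι → ℝ, ‖v‖ ^ 2 ≤ c * quad W v := by
  rcases (Metric.sphere (0 : ι → ℝ) 1).eq_empty_or_nonempty with h | h
  · refine ⟨1, one_pos, fun v => ?_⟩
    have hv : v = 0 := by
      by_contra hv
      have : ‖v‖⁻¹ • v ∈ Metric.sphere (0 : ι → ℝ) 1 := by
        simp [norm_smul, inv_mul_cancel₀ (norm_ne_zero_iff.2 hv)]
      simp [h] at this
    simp [hv]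
  · obtain ⟨v₀, hv₀, hmin⟩ := (isCompact_sphere (0 : ι → ℝ) 1).exists_isMinOn h
      (continuous_quad W).continuousOn
    have hv₀' : v₀ ≠ 0 := by rintro rfl; simp at hv₀
    have hpos := quad_pos hW hv₀'
    refine ⟨(quad W v₀)⁻¹, inv_pos.2 hpos, fun v => ?_⟩
    by_cases hv : v = 0
    · simp [hv]
    have hn : 0 < ‖v‖ := norm_pos_iff.2 hv
    have h1 : quad W v₀ ≤ quad W (‖v‖⁻¹ • v) := hmin (by simp [norm_smul, inv_mul_cancel₀ hn.ne'])
    rw [quad_smul, inv_pow] at h1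
    rw [← div_eq_inv_mul, le_div_iff₀ hpos]
    calc ‖v‖ ^ 2 * quad W v₀ ≤ ‖v‖ ^ 2 * ((‖v‖ ^ 2)⁻¹ * quad W v) := by gcongr
      _ = quad W v := by field_simp

/-- A quadratic form is bounded by a multiple of the squared norm. -/
lemma exists_abs_quad_le (W : Matrix ι ι ℝ) :
    ∃ c : ℝ, 0 ≤ c ∧ ∀ v : ι → ℝ, |quad W v| ≤ c * ‖v‖ ^ 2 := by
  refine ⟨∑ i, ∑ j, |W i j|, by positivity, fun v => ?_⟩
  simp only [quad, dotProduct, mulVec, Finset.mul_sum, Finset.sum_mul]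
  refine (Finset.abs_sum_le_sum_abs _ _).trans (Finset.sum_le_sum fun i _ => ?_)
  refine (Finset.abs_sum_le_sum_abs _ _).trans (Finset.sum_le_sum fun j _ => ?_)
  rw [abs_mul, abs_mul]
  have hi : |v i| ≤ ‖v‖ := norm_le_pi_norm v i
  have hj : |v j| ≤ ‖v‖ := norm_le_pi_norm v j
  calc |v i| * (|W i j| * |v j|) ≤ ‖v‖ * (|W i j| * ‖v‖) := by gcongr
    _ = _ := by ring

lemma tendsto_zero_of_quad {W : Matrix ι ι ℝ} (hW : W.PosDef) {v : ℕ → ι → ℝ}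
    (h : Tendsto (fun k => quad W (v k)) atTop (𝓝 0)) : Tendsto v atTop (𝓝 0) := by
  obtain ⟨c, hc, hle⟩ := exists_sq_norm_le_quad hW
  rw [tendsto_zero_iff_norm_tendsto_zero]
  have h2 : Tendsto (fun k => ‖v k‖ ^ 2) atTop (𝓝 0) :=
    squeeze_zero (fun k => by positivity) (fun k => hle (v k)) (by simpa using h.const_mul c)
  have := h2.sqrt
  simpa using this

lemma quad_fromBlocks (Q : Matrix ι ι ℝ) (M : Matrix ι κ ℝ) (Rl : Matrix κ κ ℝ)
    (x : ι → ℝ) (u : κ → ℝ) :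
    quad (fromBlocks Q M Mᵀ Rl) (Sum.elim x u) = quad Q x + quad Rl u + 2 * (x ⬝ᵥ (M *ᵥ u)) := by
  have h : u ⬝ᵥ (Mᵀ *ᵥ x) = x ⬝ᵥ (M *ᵥ u) := by
    rw [dotProduct_mulVec, vecMul_transpose, dotProduct_comm]
  simp only [quad, fromBlocks_mulVec, Sum.elim_comp_inl, Sum.elim_comp_inr,
    sumElim_dotProduct_sumElim, dotProduct_add, h]
  ring

/-- Guarantees that the matrix inverse in the Kalman gain is a genuine one. -/
lemma posDef_innovation {P : Matrix ι ι ℝ} (hP : P.PosSemidef) (H : Matrix κ ι ℝ)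
    {R : Matrix κ κ ℝ} (hR : R.PosDef) : (H * P * Hᵀ + R).PosDef := by
  have := hP.mul_mul_conjTranspose_same H
  rw [conjTranspose_eq_transpose_of_trivial] at this
  exact hR.posSemidef_add this

end Quad

/-! ### Algebra of a single Kalman update. -/

section Gain
variable {ι κ : Type} [Fintype ι] [Fintype κ] [DecidableEq ι] [DecidableEq κ]

lemma transpose_eq_of_posDef {κ : Type} {R : Matrix κ κ ℝ} (hR : R.PosDef) : Rᵀ = R := by
  simpa using hR.isHermitian.eq

lemma transpose_eq_of_posSemidef {κ : Type} {R : Matrix κ κ ℝ} (hR : R.PosSemidef) : Rᵀ = R := by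
  simpa using hR.isHermitian.eq

/-- The posterior covariance `(I - K H) P` is positive semidefinite. -/
lemma posSemidef_posterior {P : Matrix ι ι ℝ} (hP : P.PosSemidef) (H : Matrix κ ι ℝ)
    {R : Matrix κ κ ℝ} (hR : R.PosDef) :
    ((1 - P * (Hᵀ * (H * P * Hᵀ + R)⁻¹) * H) * P).PosSemidef := by
  have hT := posDef_innovation hP H hR
  have hTu := hT.isUnit
  have hTs := transpose_eq_of_posDef hT
  have hPs := transpose_eq_of_posSemidef hP
  set T := H * P * Hᵀ + R with hTdef
  set K := P * (Hᵀ * T⁻¹) with hK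
  have hdet : IsUnit T.det := (Matrix.isUnit_iff_isUnit_det T).1 hTu
  have hKT : K * T = P * Hᵀ := by
    rw [hK, Matrix.mul_assoc, Matrix.mul_assoc, Matrix.nonsing_inv_mul _ hdet, Matrix.mul_one]
  -- The Joseph form, a sum of two visibly semidefinite terms; it follows from `K * T = P * Hᵀ`.
  have key : (1 - K * H) * P = (1 - K * H) * P * (1 - K * H)ᵀ + K * R * Kᵀ := by
    have h1 : K * R = P * Hᵀ - K * (H * P * Hᵀ) := by
      rw [← hKT, hTdef, Matrix.mul_add]; abel
    rw [h1, transpose_sub, transpose_one, transpose_mul]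
    simp only [Matrix.mul_sub, Matrix.sub_mul, Matrix.mul_one, Matrix.one_mul, Matrix.mul_assoc]
    abel
  rw [key]
  have h1 := hP.mul_mul_conjTranspose_same (1 - K * H)
  have h2 := hR.posSemidef.mul_mul_conjTranspose_same K
  rw [conjTranspose_eq_transpose_of_trivial] at h1 h2
  exact h1.add h2

/-- The weighted smoothed residual is the increment of the costate. -/
lemma smoothed_residual {P : Matrix ι ι ℝ} (hP : P.PosSemidef) (H : Matrix κ ι ℝ)
    {R : Matrix κ κ ℝ} (hR : R.PosDef) (r : κ → ℝ) (μ l : ι → ℝ)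
    (hl : l = (Hᵀ * (H * P * Hᵀ + R)⁻¹) *ᵥ r
      + (1 - P * (Hᵀ * (H * P * Hᵀ + R)⁻¹) * H)ᵀ *ᵥ μ) :
    Hᵀ *ᵥ (R⁻¹ *ᵥ (r - H *ᵥ (P *ᵥ l))) = l - μ := by
  have hT := posDef_innovation hP H hR
  have hTs := transpose_eq_of_posDef hT
  have hPs := transpose_eq_of_posSemidef hP
  set T := H * P * Hᵀ + R with hTdef
  have hdet : IsUnit T.det := (Matrix.isUnit_iff_isUnit_det T).1 hT.isUnit
  have hdetR : IsUnit R.det := (Matrix.isUnit_iff_isUnit_det R).1 hR.isUnit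
  have hTi : (T⁻¹)ᵀ = T⁻¹ := by rw [transpose_nonsing_inv, hTs]
  have hKt : (1 - P * (Hᵀ * T⁻¹) * H)ᵀ = 1 - Hᵀ * T⁻¹ * H * P := by
    simp only [transpose_sub, transpose_one, transpose_mul, hTi, hPs, transpose_transpose,
      Matrix.mul_assoc]
  -- This `s` turns out to be the weighted smoothed residual: `l = Hᵀ s + μ`, and `r - H P l = R s`.
  set s := T⁻¹ *ᵥ (r - H *ᵥ (P *ᵥ μ)) with hs
  have hTs' : T *ᵥ s = r - H *ᵥ (P *ᵥ μ) := by
    rw [hs, mulVec_mulVec, Matrix.mul_nonsing_inv _ hdet, one_mulVec]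
  have hl' : l = Hᵀ *ᵥ s + μ := by
    rw [hl, hKt, hs]
    simp only [sub_mulVec, one_mulVec, mulVec_sub, mulVec_mulVec, Matrix.mul_assoc]
    abel
  have hres : r - H *ᵥ (P *ᵥ l) = R *ᵥ s := by
    have h2 : T *ᵥ s = H *ᵥ (P *ᵥ (Hᵀ *ᵥ s)) + R *ᵥ s := by
      rw [hTdef, add_mulVec]; simp only [mulVec_mulVec, Matrix.mul_assoc]
    rw [hl', mulVec_add, mulVec_add]
    rw [hTs'] at h2
    rw [← sub_sub, sub_right_comm, h2]; abel
  rw [hres, mulVec_mulVec s R⁻¹ R, Matrix.nonsing_inv_mul _ hdetR, one_mulVec, hl']; abel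

end Gain

/-! ### Schur matrices and decay of orbits. -/

section Schur
variable {ι : Type} [Fintype ι] [DecidableEq ι]

attribute [local instance] Matrix.linftyOpNormedRing Matrix.linftyOpNormedAlgebra

/-- By Gelfand's formula the powers are eventually below `q ^ k` for any `q` strictly between the
spectral radius and `1`. -/
lemma summable_norm_pow_of_spectralRadius_lt_one {A : Type*} [NormedRing A] [NormedAlgebra ℂ A]
    [CompleteSpace A] {a : A} (h : spectralRadius ℂ a < 1) : Summable (fun k : ℕ => ‖a ^ k‖) := by
  obtain ⟨q, hq1, hq2⟩ := ENNReal.lt_iff_exists_nnreal_btwn.1 h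
  have hlim := spectrum.pow_nnnorm_pow_one_div_tendsto_nhds_spectralRadius a
  have hq : (q : ℝ) < 1 := by exact_mod_cast hq2
  refine Summable.of_norm_bounded_eventually_nat (g := fun k : ℕ => (q : ℝ) ^ k)
    (summable_geometric_of_lt_one q.2 hq) ?_
  filter_upwards [hlim.eventually_lt_const hq1, eventually_gt_atTop 0] with k hk hk0
  rw [norm_norm]
  have hk' : (k : ℝ) ≠ 0 := by exact_mod_cast hk0.ne'
  have h1 : (‖a ^ k‖₊ : ENNReal) ≤ (q : ENNReal) ^ k := by
    have := ENNReal.rpow_le_rpow hk.le (Nat.cast_nonneg k : (0 : ℝ) ≤ k)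
    rwa [← ENNReal.rpow_mul, one_div, inv_mul_cancel₀ hk', ENNReal.rpow_one,
      ENNReal.rpow_natCast] at this
  have h2 : ‖a ^ k‖₊ ≤ q ^ k := by exact_mod_cast h1
  exact_mod_cast h2

/-- The powers of a Schur matrix, applied to vectors, decay summably and uniformly. -/
lemma IsSchur.exists_summable_bound {F : Matrix ι ι ℝ} (hF : IsSchur F) :
    ∃ b : ℕ → ℝ, Summable b ∧ ∀ k (v : ι → ℝ), ‖(F ^ k) *ᵥ v‖ ≤ b k * ‖v‖ := by
  refine ⟨fun k => ‖(F.map (algebraMap ℝ ℂ)) ^ k‖, ?_, fun k v => ?_⟩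
  · rcases isEmpty_or_nonempty ι with hι | hι
    · refine summable_zero.congr fun k => ?_
      rw [Subsingleton.elim (F.map (algebraMap ℝ ℂ) ^ k) 0, norm_zero]
    · apply summable_norm_pow_of_spectralRadius_lt_one
      have : CompleteSpace (Matrix ι ι ℂ) := FiniteDimensional.complete ℂ _
      have := spectrum.spectralRadius_lt_of_forall_lt (F.map (algebraMap ℝ ℂ)) (r := 1)
        (fun l hl => by exact_mod_cast hF l hl)
      exact_mod_cast this
  · have h1 : (F.map (algebraMap ℝ ℂ)) ^ k = (F ^ k).map (algebraMap ℝ ℂ) :=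
      (map_pow ((algebraMap ℝ ℂ).mapMatrix) F k).symm
    -- Complexification preserves the row-sum norm, so the complex bound controls real vectors.
    have h2 : ‖(F ^ k).map (algebraMap ℝ ℂ)‖ = ‖F ^ k‖ := by
      simp [Matrix.linfty_opNorm_def]
    simp only [h1, h2]
    exact Matrix.linfty_opNorm_mulVec _ _

/-- A quadratic form is summable along the orbits of a Schur matrix. -/
lemma IsSchur.summable_quad {F : Matrix ι ι ℝ} (hF : IsSchur F) (W : Matrix ι ι ℝ) (v : ι → ℝ) :
    Summable fun k => quad W ((F ^ k) *ᵥ v) := by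
  obtain ⟨b, hb, hle⟩ := hF.exists_summable_bound
  obtain ⟨c, hc, hW⟩ := exists_abs_quad_le W
  have hs : Summable fun k => ‖(F ^ k) *ᵥ v‖ :=
    Summable.of_nonneg_of_le (fun k => norm_nonneg _) (fun k => hle k v) (hb.mul_right _)
  refine Summable.of_norm_bounded (hs.mul_left (c * ∑' k, ‖(F ^ k) *ᵥ v‖)) fun k => ?_
  have h1 := hs.le_tsum k fun j _ => norm_nonneg _
  calc ‖quad W ((F ^ k) *ᵥ v)‖ ≤ c * ‖(F ^ k) *ᵥ v‖ ^ 2 := hW _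
    _ = c * ‖(F ^ k) *ᵥ v‖ * ‖(F ^ k) *ᵥ v‖ := by ring
    _ ≤ _ := by gcongr

/-- A stable linear system driven by a vanishing input converges to zero. -/
lemma IsSchur.tendsto_zero {F : Matrix ι ι ℝ} (hF : IsSchur F) {x d : ℕ → ι → ℝ}
    (hx : ∀ k, x (k + 1) = F *ᵥ x k + d k) (hd : Tendsto d atTop (𝓝 0)) :
    Tendsto x atTop (𝓝 0) := by
  obtain ⟨b, hb, hle⟩ := hF.exists_summable_bound
  have hb0 : ∀ (v : ι → ℝ), v ≠ 0 → ∀ k, 0 ≤ b k := fun v hv k => by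
    have := (norm_nonneg _).trans (hle k v)
    exact nonneg_of_mul_nonneg_left this (norm_pos_iff.2 hv)
  obtain ⟨c, hc⟩ := hd.norm.bddAbove_range
  have hc' : ∀ k, ‖d k‖ ≤ c := fun k => hc ⟨k, rfl⟩
  have hc0 : 0 ≤ c := (norm_nonneg _).trans (hc' 0)
  -- Variation of constants. The finite convolution is written as a series over all `j`, so that
  -- dominated convergence applies with bound `|b j| * c`.
  have hform : ∀ k, x k = (F ^ k) *ᵥ x 0
      + ∑' j, if j < k then (F ^ j) *ᵥ d (k - 1 - j) else 0 := by
    intro k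
    have hs : ∀ k, ∑' j, (if j < k then (F ^ j) *ᵥ d (k - 1 - j) else 0)
        = ∑ j ∈ Finset.range k, (F ^ j) *ᵥ d (k - 1 - j) := by
      intro k
      rw [tsum_eq_sum (s := Finset.range k) (fun j hj => by simp at hj; simp [hj])]
      exact Finset.sum_congr rfl fun j hj => by simp [Finset.mem_range.1 hj]
    rw [hs]
    induction k with
    | zero => simp
    | succ k ih =>
      rw [hx, ih, Finset.sum_range_succ', mulVec_add, mulVec_sum]
      simp only [mulVec_mulVec, ← pow_succ', pow_zero, one_mulVec]
      rw [add_assoc]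
      refine congrArg₂ _ rfl (congrArg₂ _ (Finset.sum_congr rfl fun j _ => ?_) (by simp))
      rw [show k + 1 - 1 - (j + 1) = k - 1 - j by omega]
  have h1 : Tendsto (fun k => (F ^ k) *ᵥ x 0) atTop (𝓝 0) :=
    squeeze_zero_norm (fun k => hle k (x 0)) (by simpa using hb.tendsto_atTop_zero.mul_const ‖x 0‖)
  have h2 : Tendsto (fun k => ∑' j, if j < k then (F ^ j) *ᵥ d (k - 1 - j) else 0) atTop
      (𝓝 (∑' _ : ℕ, (0 : ι → ℝ))) := by
    refine tendsto_tsum_of_dominated_convergence (bound := fun j => |b j| * c)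
      (hb.abs.mul_right c) (fun j => ?_) (Eventually.of_forall fun k j => ?_)
    · have h3 : Tendsto (fun k => (F ^ j) *ᵥ d (k - 1 - j)) atTop (𝓝 ((F ^ j) *ᵥ 0)) := by
        have h4 : Continuous fun v : ι → ℝ => (F ^ j) *ᵥ v := by fun_prop
        refine (h4.tendsto 0).comp (hd.comp ?_)
        simpa only [Nat.sub_sub] using tendsto_sub_atTop_nat (1 + j)
      rw [mulVec_zero] at h3
      refine h3.congr' ?_
      filter_upwards [eventually_gt_atTop j] with k hk
      simp [hk]
    · split_ifs
      · refine (hle _ _).trans ?_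
        gcongr
        · exact le_abs_self _
        · exact hc' _
      · simp; positivity
  have := h1.add h2
  rw [tsum_zero, add_zero] at this
  exact this.congr fun k => (hform k).symm

/-- A matrix all of whose orbits converge to zero is Schur. -/
lemma isSchur_of_tendsto {F : Matrix ι ι ℝ}
    (h : ∀ v : ι → ℝ, Tendsto (fun k => (F ^ k) *ᵥ v) atTop (𝓝 0)) : IsSchur F := by
  intro l hl
  rw [← spectrum_toLin', ← Module.End.hasEigenvalue_iff_mem_spectrum] at hl
  obtain ⟨v, hv⟩ := hl.exists_hasEigenvector
  have hFv : F.map (algebraMap ℝ ℂ) *ᵥ v = l • v := by simpa using hv.apply_eq_smul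
  have hpow : ∀ k : ℕ, ((F ^ k).map (algebraMap ℝ ℂ)) *ᵥ v = l ^ k • v := by
    intro k
    induction k with
    | zero => simp
    | succ k ih =>
      rw [pow_succ, Matrix.map_mul, ← mulVec_mulVec, hFv, mulVec_smul, ih, smul_smul, pow_succ']
  -- The hypothesis concerns real vectors only, so the complex eigenvector is split into real and
  -- imaginary parts; a nonzero coordinate then gives `l ^ k → 0`.
  have hreal : ∀ (k : ℕ) (i : ι), (((F ^ k).map (algebraMap ℝ ℂ)) *ᵥ v) i
      = (((F ^ k) *ᵥ fun j => (v j).re) i : ℂ) + (((F ^ k) *ᵥ fun j => (v j).im) i : ℂ) * Complex.I := by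
    intro k i
    simp only [mulVec, dotProduct, map_apply, Complex.ofReal_sum, Complex.ofReal_mul,
      Finset.sum_mul, ← Finset.sum_add_distrib]
    refine Finset.sum_congr rfl fun j _ => ?_
    conv_lhs => rw [← Complex.re_add_im (v j)]
    simp only [Complex.coe_algebraMap]
    ring
  obtain ⟨i, hi⟩ := Function.ne_iff.1 hv.2
  have hlim : Tendsto (fun k => l ^ k * v i) atTop (𝓝 0) := by
    have h1 := tendsto_pi_nhds.1 (h fun j => (v j).re) i
    have h2 := tendsto_pi_nhds.1 (h fun j => (v j).im) i
    have h3 := ((Complex.continuous_ofReal.tendsto _).comp h1).add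
      (((Complex.continuous_ofReal.tendsto _).comp h2).mul_const Complex.I)
    simp only [Pi.zero_apply, Complex.ofReal_zero, zero_mul, add_zero] at h3
    refine h3.congr fun k => ?_
    have h5 := hreal k i
    rw [hpow k, Pi.smul_apply, smul_eq_mul] at h5
    rw [h5]
    rfl
  have hlim' : Tendsto (fun k => l ^ k) atTop (𝓝 0) := by
    have := hlim.mul_const (v i)⁻¹
    rw [zero_mul] at this
    refine this.congr fun k => ?_
    rw [mul_assoc, mul_inv_cancel₀ hi, mul_one]
  exact tendsto_pow_atTop_nhds_zero_iff_norm_lt_one.1 hlim'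

end Schur

/-! ### Block matrices, ordered products and midpoints of controls. -/

section Selection
variable {n m : ℕ}

lemma ctrlSel_mulVec (v : AugIdx n m → ℝ) : ctrlSel n m *ᵥ v = v ∘ Sum.inr := by
  rw [ctrlSel, ← Sum.elim_comp_inl_inr v, fromCols_mulVec_sumElim]
  simp

lemma ctrlSel_transpose_mulVec (w : Fin m → ℝ) :
    (ctrlSel n m)ᵀ *ᵥ w = Sum.elim (0 : Fin n → ℝ) w := by
  rw [ctrlSel, transpose_fromCols, fromRows_mulVec]
  simp

lemma augPhi_mulVec (A : Matrix (Fin n) (Fin n) ℝ) (B : Matrix (Fin n) (Fin m) ℝ)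
    (x : Fin n → ℝ) (u : Fin m → ℝ) :
    augPhi A B *ᵥ Sum.elim x u = Sum.elim (A *ᵥ x + B *ᵥ u) u := by
  simp [augPhi, fromBlocks_mulVec]

end Selection

lemma prodIco_self {ι : Type} [Fintype ι] [DecidableEq ι] (F : ℕ → Matrix ι ι ℝ) (a : ℕ) :
    prodIco F a a = 1 := by
  cases a <;> simp [prodIco]

lemma prodIco_succ {ι : Type} [Fintype ι] [DecidableEq ι] (F : ℕ → Matrix ι ι ℝ) {a b : ℕ}
    (h : a ≤ b) : prodIco F a (b + 1) = F b * prodIco F a b := by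
  simp [prodIco, h]

/-- The pointwise midpoint of two control sequences. -/
def midCtrl {m : ℕ} (u v : ℕ → Fin m → ℝ) : ℕ → Fin m → ℝ := fun k => (1 / 2 : ℝ) • (u k + v k)

lemma plantState_midCtrl {n m : ℕ} (A : ℕ → Matrix (Fin n) (Fin n) ℝ)
    (B : ℕ → Matrix (Fin n) (Fin m) ℝ) (x0 : Fin n → ℝ) (u v : ℕ → Fin m → ℝ) (k : ℕ) :
    plantState A B x0 (midCtrl u v) k
      = (1 / 2 : ℝ) • (plantState A B x0 u k + plantState A B x0 v k) := by
  induction k with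
  | zero => simp only [plantState]; module
  | succ k ih => simp only [plantState, ih, midCtrl, mulVec_smul, mulVec_add]; module

lemma prevCtrl_midCtrl {m : ℕ} (uLast : Fin m → ℝ) (u v : ℕ → Fin m → ℝ) (k : ℕ) :
    prevCtrl uLast (midCtrl u v) k = (1 / 2 : ℝ) • (prevCtrl uLast u k + prevCtrl uLast v k) := by
  cases k
  · simp only [prevCtrl]; module
  · simp only [prevCtrl, midCtrl]

/-! ### Strong convexity and adjoint optimality conditions. -/

namespace LQMPC
variable {n m : ℕ} {p : ℕ → ℕ} (D : LQMPC n m p) (x0 : Fin n → ℝ) (uLast : Fin m → ℝ)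
  (z : (k : ℕ) → MeasIdx n m p k → ℝ)

/-- The total cost over the horizon `0, …, N`. -/
def cost (N : ℕ) (u : ℕ → Fin m → ℝ) : ℝ := ∑ k ∈ Finset.range (N + 1), D.stage x0 uLast z u k

/-- The augmented state `χ_k = (x_k, u_k)`. -/
def augState (u : ℕ → Fin m → ℝ) (k : ℕ) : AugIdx n m → ℝ :=
  Sum.elim (plantState D.A D.B x0 u k) (u k)

/-- The augmented state `(x_k, u_{k-1})` before the control is updated. -/
def augPrior (u : ℕ → Fin m → ℝ) (k : ℕ) : AugIdx n m → ℝ :=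
  Sum.elim (plantState D.A D.B x0 u k) (prevCtrl uLast u k)

lemma augPrior_succ (u : ℕ → Fin m → ℝ) (k : ℕ) :
    D.augPrior x0 uLast u (k + 1) = D.Phi k *ᵥ D.augState x0 u k := by
  rw [Phi, augState, augPhi_mulVec]; rfl

/-- The increment acts as an input on the control block alone, just as process noise of covariance
`Qc` does in the filter. -/
lemma augState_eq (u : ℕ → Fin m → ℝ) (k : ℕ) :
    D.augState x0 u k
      = D.augPrior x0 uLast u k + (ctrlSel n m)ᵀ *ᵥ (u k - prevCtrl uLast u k) := by
  rw [ctrlSel_transpose_mulVec, augPrior, augState]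
  ext (i | i) <;> simp

variable {D x0 uLast z}

lemma stage_nonneg (hR : ∀ k, (D.R k).PosDef) (hRt : D.Rt.PosDef) (u : ℕ → Fin m → ℝ) (k : ℕ) :
    0 ≤ D.stage x0 uLast z u k :=
  add_nonneg (quad_nonneg (hR k).inv.posSemidef _) (quad_nonneg hRt.posSemidef _)

/-- The trajectory is affine in the controls, so the parallelogram law applies to both terms of the
stage; only the surplus of the rate term is kept. -/
lemma stage_midCtrl_le (hR : ∀ k, (D.R k).PosDef) (u v : ℕ → Fin m → ℝ) (k : ℕ) :
    D.stage x0 uLast z (midCtrl u v) k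
      + (1 / 4) * quad D.Rt ((u k - prevCtrl uLast u k) - (v k - prevCtrl uLast v k))
      ≤ (D.stage x0 uLast z u k + D.stage x0 uLast z v k) / 2 := by
  have h1 : Sum.elim (plantState D.A D.B x0 (midCtrl u v) k) (midCtrl u v k)
      = (1 / 2 : ℝ) • (Sum.elim (plantState D.A D.B x0 u k) (u k)
        + Sum.elim (plantState D.A D.B x0 v k) (v k)) := by
    rw [plantState_midCtrl]
    ext (i | i) <;> simp [midCtrl, mul_add]
  have h2 : midCtrl u v k - prevCtrl uLast (midCtrl u v) k
      = (1 / 2 : ℝ) • ((u k - prevCtrl uLast u k) + (v k - prevCtrl uLast v k)) := by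
    rw [prevCtrl_midCtrl, midCtrl]; module
  set a := z k - D.H k *ᵥ Sum.elim (plantState D.A D.B x0 u k) (u k) with ha
  set b := z k - D.H k *ᵥ Sum.elim (plantState D.A D.B x0 v k) (v k) with hb
  have h3 : z k - D.H k *ᵥ Sum.elim (plantState D.A D.B x0 (midCtrl u v) k) (midCtrl u v k)
      = (1 / 2 : ℝ) • (a + b) := by
    rw [h1, mulVec_smul, mulVec_add, ha, hb]; module
  have h4 := quad_midpoint (D.R k)⁻¹ a b
  have h5 := quad_midpoint D.Rt (u k - prevCtrl uLast u k) (v k - prevCtrl uLast v k)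
  have h6 := quad_nonneg (hR k).inv.posSemidef (a - b)
  simp only [stage, h3, h2, ← ha, ← hb]
  linarith

/-- Strong convexity of the cost: near-optimal controls have nearly the same increments. -/
lemma IsOptimal.sum_quad_le (hR : ∀ k, (D.R k).PosDef) {N : ℕ} {u : ℕ → Fin m → ℝ}
    (hu : D.IsOptimal x0 uLast z N u) (v : ℕ → Fin m → ℝ) :
    ∑ k ∈ Finset.range (N + 1),
        quad D.Rt ((u k - prevCtrl uLast u k) - (v k - prevCtrl uLast v k))
      ≤ 2 * (D.cost x0 uLast z N v - D.cost x0 uLast z N u) := by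
  have h1 := hu (midCtrl u v)
  have h2 := Finset.sum_le_sum fun k (_ : k ∈ Finset.range (N + 1)) =>
    stage_midCtrl_le (x0 := x0) (uLast := uLast) (z := z) hR u v k
  rw [Finset.sum_add_distrib, ← Finset.mul_sum, ← Finset.sum_div, Finset.sum_add_distrib] at h2
  simp only [cost]
  linarith

/-- Two minimizers have equal cost, so their increments agree; at time `0` both start from `uLast`,
and equal increments mean equal controls. -/
lemma IsOptimal.zero_eq (hR : ∀ k, (D.R k).PosDef) (hRt : D.Rt.PosDef) {N : ℕ}
    {u v : ℕ → Fin m → ℝ} (hu : D.IsOptimal x0 uLast z N u) (hv : D.IsOptimal x0 uLast z N v) :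
    u 0 = v 0 := by
  have h1 := hu.sum_quad_le hR v
  have h2 := hv u
  have h3 := Finset.single_le_sum (f := fun k =>
      quad D.Rt ((u k - prevCtrl uLast u k) - (v k - prevCtrl uLast v k)))
    (fun k _ => quad_nonneg hRt.posSemidef _) (Finset.mem_range.2 N.succ_pos)
  have h4 : quad D.Rt (u 0 - v 0) ≤ 0 := by
    have h5 : (u 0 - prevCtrl uLast u 0) - (v 0 - prevCtrl uLast v 0) = u 0 - v 0 :=
      sub_sub_sub_cancel_right _ _ _
    rw [← h5]
    simp only [cost] at h1
    linarith
  by_contra hne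
  exact absurd (quad_pos hRt (sub_ne_zero.2 hne)) (not_lt.2 h4)

/-- The variational inequality satisfied by a control with an adjoint sequence `l`. -/
lemma stage_add_le (hR : ∀ k, (D.R k).PosDef) (hRt : D.Rt.PosDef) {u : ℕ → Fin m → ℝ}
    {l : ℕ → AugIdx n m → ℝ} {k : ℕ}
    (h1 : (D.H k)ᵀ *ᵥ ((D.R k)⁻¹ *ᵥ (z k - D.H k *ᵥ D.augState x0 u k))
      = l k - (D.Phi k)ᵀ *ᵥ l (k + 1))
    (h2 : D.Rt *ᵥ (u k - prevCtrl uLast u k) = ctrlSel n m *ᵥ l k) (v : ℕ → Fin m → ℝ) :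
    D.stage x0 uLast z u k
      + 2 * ((D.augPrior x0 uLast v (k + 1) - D.augPrior x0 uLast u (k + 1)) ⬝ᵥ l (k + 1)
        - (D.augPrior x0 uLast v k - D.augPrior x0 uLast u k) ⬝ᵥ l k)
      ≤ D.stage x0 uLast z v k := by
  set a := z k - D.H k *ᵥ D.augState x0 u k with ha
  set dχ := D.augState x0 v k - D.augState x0 u k with hdχ
  set dξ := D.augPrior x0 uLast v k - D.augPrior x0 uLast u k with hdξ
  set w := u k - prevCtrl uLast u k with hw
  set dw := (v k - prevCtrl uLast v k) - w with hdw
  have e1 : z k - D.H k *ᵥ D.augState x0 v k = a + -(D.H k *ᵥ dχ) := by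
    rw [ha, hdχ, mulVec_sub]; abel
  have e2 : v k - prevCtrl uLast v k = w + dw := by rw [hdw]; abel
  have e3 : dχ = dξ + (ctrlSel n m)ᵀ *ᵥ dw := by
    rw [hdχ, augState_eq D x0 uLast v, augState_eq D x0 uLast u, hdξ, hdw, hw]
    simp only [mulVec_sub]; abel
  have e4 : D.augPrior x0 uLast v (k + 1) - D.augPrior x0 uLast u (k + 1) = D.Phi k *ᵥ dχ := by
    rw [augPrior_succ, augPrior_succ, hdχ, mulVec_sub]
  -- `c1` and `c2` evaluate the first-order terms of the two squares. The contributions `dχ ⬝ᵥ l k`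
  -- cancel between them, which leaves a telescoping difference; the second-order terms are
  -- nonnegative.
  have c1 : (D.H k *ᵥ dχ) ⬝ᵥ ((D.R k)⁻¹ *ᵥ a) = dχ ⬝ᵥ l k - (D.Phi k *ᵥ dχ) ⬝ᵥ l (k + 1) := by
    have : (D.H k *ᵥ dχ) ⬝ᵥ ((D.R k)⁻¹ *ᵥ a) = dχ ⬝ᵥ ((D.H k)ᵀ *ᵥ ((D.R k)⁻¹ *ᵥ a)) := by
      rw [dotProduct_mulVec dχ, vecMul_transpose]
    rw [this, h1, dotProduct_sub, dotProduct_mulVec dχ, vecMul_transpose]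
  have c2 : dw ⬝ᵥ (D.Rt *ᵥ w) = dχ ⬝ᵥ l k - dξ ⬝ᵥ l k := by
    rw [h2, e3, add_dotProduct, dotProduct_mulVec, ← mulVec_transpose]; ring
  have s1 : D.stage x0 uLast z u k = quad (D.R k)⁻¹ a + quad D.Rt w := rfl
  have s2 : D.stage x0 uLast z v k = quad (D.R k)⁻¹ (z k - D.H k *ᵥ D.augState x0 v k)
    + quad D.Rt (v k - prevCtrl uLast v k) := rfl
  rw [s1, s2, e1, e2, e4, quad_add (transpose_eq_of_posDef (hR k).inv),
    quad_add (transpose_eq_of_posDef hRt), quad_neg, neg_dotProduct, c1, c2]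
  have q1 := quad_nonneg (hR k).inv.posSemidef (D.H k *ᵥ dχ)
  have q2 := quad_nonneg hRt.posSemidef dw
  linarith

/-- The stagewise inequalities telescope. Both boundary terms vanish: all controls share the same
`(x_0, u_{-1})`, and the adjoint is zero at `N + 1`. -/
lemma isOptimal_of_adjoint (hR : ∀ k, (D.R k).PosDef) (hRt : D.Rt.PosDef) {N : ℕ}
    {u : ℕ → Fin m → ℝ} {l : ℕ → AugIdx n m → ℝ}
    (h1 : ∀ k ≤ N, (D.H k)ᵀ *ᵥ ((D.R k)⁻¹ *ᵥ (z k - D.H k *ᵥ D.augState x0 u k))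
      = l k - (D.Phi k)ᵀ *ᵥ l (k + 1))
    (h2 : ∀ k ≤ N, D.Rt *ᵥ (u k - prevCtrl uLast u k) = ctrlSel n m *ᵥ l k)
    (hl : l (N + 1) = 0) : D.IsOptimal x0 uLast z N u := by
  intro v
  have := Finset.sum_le_sum fun k (hk : k ∈ Finset.range (N + 1)) =>
    stage_add_le hR hRt (h1 k (Nat.lt_succ_iff.1 (Finset.mem_range.1 hk)))
      (h2 k (Nat.lt_succ_iff.1 (Finset.mem_range.1 hk))) v
  rw [Finset.sum_add_distrib, ← Finset.mul_sum, Finset.sum_range_sub (fun k =>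
    (D.augPrior x0 uLast v k - D.augPrior x0 uLast u k) ⬝ᵥ l k), hl] at this
  simpa [augPrior, plantState, prevCtrl] using this

/-! ### The smoother -/

lemma Qc_eq : D.Qc = (ctrlSel n m)ᵀ * D.Rt⁻¹ * ctrlSel n m := by
  rw [Qc, ctrlSel, transpose_fromCols, Matrix.mul_assoc, Matrix.mul_fromCols,
    fromRows_mul_fromCols]
  simp

lemma Qc_mulVec (v : AugIdx n m → ℝ) :
    D.Qc *ᵥ v = (ctrlSel n m)ᵀ *ᵥ (D.Rt⁻¹ *ᵥ (ctrlSel n m *ᵥ v)) := by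
  rw [Qc_eq, ← mulVec_mulVec, ← mulVec_mulVec]

lemma ctrlSel_mul_transpose_mulVec (w : Fin m → ℝ) :
    ctrlSel n m *ᵥ ((ctrlSel n m)ᵀ *ᵥ w) = w := by
  rw [ctrlSel_transpose_mulVec, ctrlSel_mulVec, Sum.elim_comp_inr]

lemma posSemidef_P (hR : ∀ k, (D.R k).PosDef) (hRt : D.Rt.PosDef) (k : ℕ) :
    (D.P k).PosSemidef := by
  have hQ : D.Qc.PosSemidef := by
    rw [Qc_eq, ← conjTranspose_eq_transpose_of_trivial]
    exact hRt.inv.posSemidef.conjTranspose_mul_mul_same _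
  induction k with
  | zero => exact hQ
  | succ k ih =>
    rw [P]
    refine PosSemidef.add ?_ hQ
    have := (posSemidef_posterior ih (D.H k) (hR k)).mul_mul_conjTranspose_same (D.Phi k)
    rwa [conjTranspose_eq_transpose_of_trivial] at this

variable (D x0 uLast z)

/-- The costate `∑_{j < d} (∏_{i=k}^{k+j-1} Φ_i (I - K_i H_i))ᵀ S_{k+j} r_{k+j}`. -/
def costate : ℕ → ℕ → AugIdx n m → ℝ
  | 0, _ => 0
  | d + 1, k => D.S k *ᵥ D.residual x0 uLast z k + (D.step k)ᵀ *ᵥ costate d (k + 1)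

/-- The smoothed augmented state for the horizon `0, …, N`. -/
def smooth (N k : ℕ) : AugIdx n m → ℝ :=
  D.prior x0 uLast z k + D.P k *ᵥ D.costate x0 uLast z (N + 1 - k) k

/-- The smoothed control for the horizon `0, …, N`. -/
def smoothCtrl (N k : ℕ) : Fin m → ℝ := ctrlSel n m *ᵥ D.smooth x0 uLast z N k

variable {D x0 uLast z}

/-- The costate terms carried through `Φ_k` reproduce `P_{k+1(-)} l_{k+1}` except for its summand
`Qc l_{k+1}`, which remains as the input. -/
lemma smooth_succ (hR : ∀ k, (D.R k).PosDef) (hRt : D.Rt.PosDef) {N k : ℕ} (hk : k ≤ N) :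
    D.smooth x0 uLast z N (k + 1) = D.Phi k *ᵥ D.smooth x0 uLast z N k
      + D.Qc *ᵥ D.costate x0 uLast z (N + 1 - (k + 1)) (k + 1) := by
  have hP := transpose_eq_of_posSemidef (posSemidef_P hR hRt k)
  obtain ⟨d, hd⟩ : ∃ d, N + 1 - k = d + 1 := ⟨N - k, by omega⟩
  have hd' : N + 1 - (k + 1) = d := by omega
  -- Symmetry of the posterior covariance moves the factor `I - K_k H_k` to the left of `P_{k(-)}`.
  have hS : D.P k * (D.step k)ᵀ = (1 - D.K k * D.H k) * D.P k * (D.Phi k)ᵀ := by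
    have h : ((1 - D.K k * D.H k) * D.P k)ᵀ = (1 - D.K k * D.H k) * D.P k :=
      transpose_eq_of_posSemidef (posSemidef_posterior (posSemidef_P hR hRt k) (D.H k) (hR k))
    rw [← h, transpose_mul, hP, step, transpose_mul, Matrix.mul_assoc]
  rw [smooth, smooth, hd, hd', costate, prior, P, add_mulVec, mulVec_add (D.P k), mulVec_mulVec,
    mulVec_mulVec, hS]
  change _ + ((D.Phi k * ((1 - D.K k * D.H k) * D.P k) * (D.Phi k)ᵀ) *ᵥ _ + _) = _
  simp only [mulVec_add, mulVec_mulVec, Matrix.mul_assoc, residual, K]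
  abel

/-- `Qc` has its range in the control block, so the smoothed sequence is a true plant trajectory,
with increments `Rt⁻¹ [O I] l_k`. -/
lemma trajectory_smoothCtrl (hR : ∀ k, (D.R k).PosDef) (hRt : D.Rt.PosDef) {N k : ℕ} (hk : k ≤ N) :
    D.augState x0 (D.smoothCtrl x0 uLast z N) k = D.smooth x0 uLast z N k ∧
    D.augPrior x0 uLast (D.smoothCtrl x0 uLast z N) k
      + D.Qc *ᵥ D.costate x0 uLast z (N + 1 - k) k = D.smooth x0 uLast z N k := by
  set u := D.smoothCtrl x0 uLast z N with hu
  have key : ∀ j, D.augPrior x0 uLast u j + D.Qc *ᵥ D.costate x0 uLast z (N + 1 - j) j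
      = D.smooth x0 uLast z N j → D.augState x0 u j = D.smooth x0 uLast z N j := by
    intro j hj
    have h1 : u j = prevCtrl uLast u j
        + D.Rt⁻¹ *ᵥ (ctrlSel n m *ᵥ D.costate x0 uLast z (N + 1 - j) j) := by
      have h2 : u j = ctrlSel n m *ᵥ D.smooth x0 uLast z N j := rfl
      rw [h2, ← hj, mulVec_add, Qc_mulVec, ctrlSel_mul_transpose_mulVec, ctrlSel_mulVec _,
        augPrior, Sum.elim_comp_inr]
    rw [augState_eq D x0 uLast, ← hj, Qc_mulVec]
    congr 2
    rw [h1]; abel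
  induction k with
  | zero =>
    have h0 : D.augPrior x0 uLast u 0 + D.Qc *ᵥ D.costate x0 uLast z (N + 1 - 0) 0
      = D.smooth x0 uLast z N 0 := rfl
    exact ⟨key 0 h0, h0⟩
  | succ k ih =>
    have h0 : D.augPrior x0 uLast u (k + 1)
        + D.Qc *ᵥ D.costate x0 uLast z (N + 1 - (k + 1)) (k + 1)
        = D.smooth x0 uLast z N (k + 1) := by
      rw [smooth_succ hR hRt (by omega), augPrior_succ, (ih (by omega)).1]
    exact ⟨key _ h0, h0⟩

lemma isOptimal_smoothCtrl (hR : ∀ k, (D.R k).PosDef) (hRt : D.Rt.PosDef) (N : ℕ) :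
    D.IsOptimal x0 uLast z N (D.smoothCtrl x0 uLast z N) := by
  -- `N + 1 - k` counts the measurements still to come at time `k`; at `N + 1` none is left and the
  -- costate is zero.
  refine isOptimal_of_adjoint hR hRt (l := fun k => D.costate x0 uLast z (N + 1 - k) k)
    (fun k hk => ?_) (fun k hk => ?_) (by simp [costate])
  · obtain ⟨d, hd⟩ : ∃ d, N + 1 - k = d + 1 := ⟨N - k, by omega⟩
    have hd' : N + 1 - (k + 1) = d := by omega
    rw [(trajectory_smoothCtrl hR hRt hk).1, smooth, hd, hd', mulVec_add, ← sub_sub]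
    refine smoothed_residual (posSemidef_P hR hRt k) (D.H k) (hR k) (D.residual x0 uLast z k) _ _ ?_
    rw [mulVec_mulVec, ← transpose_mul]
    rfl
  · have h := trajectory_smoothCtrl (x0 := x0) (uLast := uLast) (z := z) hR hRt hk
    have h1 := congrArg (fun v => ctrlSel n m *ᵥ v) h.2
    simp only [mulVec_add, Qc_mulVec, ctrlSel_mul_transpose_mulVec] at h1
    rw [ctrlSel_mulVec (D.augPrior _ _ _ _), augPrior, Sum.elim_comp_inr] at h1
    have h2 : D.smoothCtrl x0 uLast z N k = ctrlSel n m *ᵥ D.smooth x0 uLast z N k := rfl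
    rw [h2, ← h1, add_sub_cancel_left, mulVec_mulVec, Matrix.mul_nonsing_inv, one_mulVec]
    exact (Matrix.isUnit_iff_isUnit_det _).1 hRt.isUnit

/-- The recursion for `G` absorbs one transposed filter step per time index, so the backward costate
becomes the forward sum of the observed-control output. -/
lemma GPrev_mulVec_costate (d k : ℕ) :
    (D.GPrev k * (D.PhiPrev k)ᵀ) *ᵥ D.costate x0 uLast z d k
      = ∑ j ∈ Finset.range d,
        (fun i => (D.GPrev i * (D.PhiPrev i)ᵀ * D.S i) *ᵥ D.residual x0 uLast z i) (k + j) := by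
  induction d generalizing k with
  | zero => simp [costate]
  | succ d ih =>
    have h : D.GPrev k * (D.PhiPrev k)ᵀ * (D.step k)ᵀ
        = D.GPrev (k + 1) * (D.PhiPrev (k + 1))ᵀ := by
      simp only [GPrev, PhiPrev, step, transpose_mul, Matrix.mul_assoc]
    rw [Finset.sum_range_succ', costate, mulVec_add, mulVec_mulVec, mulVec_mulVec, h, ih, add_comm]
    refine congrArg₂ _ (Finset.sum_congr rfl fun j _ => ?_) rfl
    rw [show k + (j + 1) = k + 1 + j by omega]

lemma smoothCtrl_zero (N : ℕ) :
    D.smoothCtrl x0 uLast z N 0 = D.output x0 uLast z N := by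
  have h : (D.GPrev 0 * (D.PhiPrev 0)ᵀ) *ᵥ D.costate x0 uLast z (N + 1) 0
      = ∑ k ∈ Finset.range (N + 1),
        (D.GPrev k * (D.PhiPrev k)ᵀ * D.S k) *ᵥ D.residual x0 uLast z k := by
    rw [GPrev_mulVec_costate]
    exact Finset.sum_congr rfl fun k _ => by rw [zero_add]
  rw [output, ← h, smoothCtrl, smooth, mulVec_add, prior, ctrlSel_mulVec (Sum.elim _ _),
    Sum.elim_comp_inr]
  simp [GPrev, PhiPrev, mulVec_mulVec]

/-! ### The factorization of the output -/

variable (D) in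
/-- The coefficient of `z_k` in the prior mean at time `b`, when that mean is written as a function
of the targets and of the first residual. -/
def priorCoeff (b : ℕ) : (k : ℕ) → Matrix (AugIdx n m) (MeasIdx n m p k) ℝ
  | 0 =>
      let L : Matrix (AugIdx n m) (AugIdx n m) ℝ := prodIco D.step 1 b * D.Phi 0
      L
  | k + 1 => prodIco D.step (k + 2) b * D.Phi (k + 1) * D.K (k + 1)

lemma priorCoeff_succ {b k : ℕ} (h : k < b) :
    D.priorCoeff (b + 1) k = D.step b * D.priorCoeff b k := by
  cases k with
  | zero =>
    change prodIco D.step 1 (b + 1) * D.Phi 0 = D.step b * (prodIco D.step 1 b * D.Phi 0)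
    rw [prodIco_succ _ (by omega), Matrix.mul_assoc]
  | succ k =>
    rw [priorCoeff, priorCoeff, prodIco_succ _ (by omega)]
    simp only [Matrix.mul_assoc]

lemma prior_succ (k : ℕ) : D.prior x0 uLast z (k + 1)
    = D.step k *ᵥ D.prior x0 uLast z k + (D.Phi k * D.K k) *ᵥ z k := by
  rw [prior, step, ← mulVec_mulVec, ← mulVec_mulVec, sub_mulVec, one_mulVec, ← mulVec_mulVec,
    mulVec_sub (D.K k), ← mulVec_add]
  congr 1
  abel

variable (D x0 uLast z) in
/-- The first residual, as a vector indexed by the augmented state. -/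
def initResidual : AugIdx n m → ℝ := D.residual x0 uLast z 0

variable (z) in
/-- The first target, as a vector indexed by the augmented state. -/
def initTarget : AugIdx n m → ℝ := z 0

variable (D) in
/-- The first Kalman gain, as a matrix indexed by the augmented state. -/
def initGain : Matrix (AugIdx n m) (AugIdx n m) ℝ := D.K 0

lemma initResidual_eq (hH : D.H 0 = (1 : Matrix (AugIdx n m) (AugIdx n m) ℝ)) :
    D.initResidual x0 uLast z = initTarget z - Sum.elim x0 uLast := by
  rw [initResidual, residual, hH]
  exact congrArg (fun v => initTarget z - v) (one_mulVec (D.prior x0 uLast z 0))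

lemma step_zero (hH : D.H 0 = (1 : Matrix (AugIdx n m) (AugIdx n m) ℝ)) :
    D.step 0 = D.Phi 0 - D.Phi 0 * D.initGain := by
  have h : D.K 0 * D.H 0 = D.initGain := by
    rw [hH]; exact Matrix.mul_one D.initGain
  rw [step, h, Matrix.mul_sub, Matrix.mul_one]

/-- Full-state feedback replaces `(x_0, u_{-1})` by `z_0 - r_0` in the first update, giving `-Φ_0 (I
- K_0) r_0 + Φ_0 z_0`; later updates propagate this linearly. -/
lemma prior_eq (hH : D.H 0 = (1 : Matrix (AugIdx n m) (AugIdx n m) ℝ)) (b : ℕ) :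
    D.prior x0 uLast z (b + 1) = -(prodIco D.step 0 (b + 1) *ᵥ D.initResidual x0 uLast z)
      + ∑ k ∈ Finset.range (b + 1), D.priorCoeff (b + 1) k *ᵥ z k := by
  induction b with
  | zero =>
    have hc : D.priorCoeff 1 0 *ᵥ z 0 = D.Phi 0 *ᵥ initTarget z := by
      change (prodIco D.step 1 1 * D.Phi 0) *ᵥ initTarget z = _
      rw [prodIco_self, Matrix.one_mul]
    have hp : D.prior x0 uLast z 1
        = D.step 0 *ᵥ Sum.elim x0 uLast + (D.Phi 0 * D.initGain) *ᵥ initTarget z := prior_succ 0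
    rw [zero_add, Finset.sum_range_one, hc, prodIco_succ _ le_rfl, prodIco_self, Matrix.mul_one,
      hp, initResidual_eq hH, step_zero hH]
    simp only [sub_mulVec, mulVec_sub]
    abel
  | succ b ih =>
    have hc : D.priorCoeff (b + 2) (b + 1) = D.Phi (b + 1) * D.K (b + 1) := by
      rw [priorCoeff, prodIco_self, Matrix.one_mul]
    rw [prior_succ, ih, Finset.sum_range_succ _ (b + 1), hc, prodIco_succ _ (Nat.zero_le (b + 1)),
      mulVec_add, mulVec_neg, mulVec_mulVec, mulVec_sum, add_assoc]
    have hs : ∀ k ∈ Finset.range (b + 1), D.step (b + 1) *ᵥ (D.priorCoeff (b + 1) k *ᵥ z k)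
        = D.priorCoeff (b + 2) k *ᵥ z k := fun k hk => by
      rw [priorCoeff_succ (Finset.mem_range.1 hk), mulVec_mulVec]
    rw [Finset.sum_congr rfl hs]

variable (D) in
/-- The first term `G_{-1} S_0` of the reactive gain, indexed by the augmented state. -/
def initReactive : Matrix (Fin m) (AugIdx n m) ℝ := D.GPrev 0 * D.S 0

lemma Keff_eq (N : ℕ) : D.Keff N = D.initReactive + ∑ k ∈ Finset.Icc 1 N,
    D.GPrev k * (D.PhiPrev k)ᵀ * D.S k * D.H k * prodIco D.step 0 k := rfl

lemma Keff_succ (N : ℕ) : D.Keff (N + 1) = D.Keff N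
    + D.GPrev (N + 1) * (D.PhiPrev (N + 1))ᵀ * D.S (N + 1) * D.H (N + 1)
      * prodIco D.step 0 (N + 1) := by
  rw [Keff_eq, Keff_eq, Finset.sum_Icc_succ_top (by omega), add_assoc]

lemma Lam_succ {N k : ℕ} (h : k ≤ N) : D.Lam (N + 1) k = D.Lam N k
    - D.GPrev (N + 1) * (D.PhiPrev (N + 1))ᵀ * D.S (N + 1) * D.H (N + 1)
      * D.priorCoeff (N + 1) k := by
  cases k with
  | zero =>
    change (-∑ k ∈ Finset.Icc 1 (N + 1), D.GPrev k * (D.PhiPrev k)ᵀ * D.S k * D.H k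
        * prodIco D.step 1 k * D.Phi 0) = (-∑ k ∈ Finset.Icc 1 N,
        D.GPrev k * (D.PhiPrev k)ᵀ * D.S k * D.H k * prodIco D.step 1 k * D.Phi 0)
        - D.GPrev (N + 1) * (D.PhiPrev (N + 1))ᵀ * D.S (N + 1) * D.H (N + 1)
          * (prodIco D.step 1 (N + 1) * D.Phi 0)
    rw [Finset.sum_Icc_succ_top (by omega), neg_add, ← sub_eq_add_neg]
    simp only [Matrix.mul_assoc]
  | succ k =>
    rw [Lam, Lam, Finset.sum_Icc_succ_top (by omega), ← sub_sub, priorCoeff]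
    simp only [Matrix.mul_assoc]

lemma Lam_self (N : ℕ) : D.Lam (N + 1) (N + 1)
    = D.GPrev (N + 1) * (D.PhiPrev (N + 1))ᵀ * D.S (N + 1) := by
  rw [Lam, Finset.Icc_eq_empty (by omega), Finset.sum_empty, sub_zero]

/-- Lengthening the horizon adds one term in the new residual. Expanding its prior mean by
`prior_eq` yields exactly the increments of `Keff` and `Lam`. -/
theorem output_eq (hH : D.H 0 = (1 : Matrix (AugIdx n m) (AugIdx n m) ℝ)) (N : ℕ) :
    D.output x0 uLast z N = uLast + D.Keff N *ᵥ D.initResidual x0 uLast z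
      + ∑ k ∈ Finset.range (N + 1), D.Lam N k *ᵥ z k := by
  induction N with
  | zero =>
    have hL : D.Lam 0 0 *ᵥ z 0 = 0 := by
      have : D.Lam 0 0 = 0 := by simp [Lam]; rfl
      rw [this, zero_mulVec]
    have hg : (D.GPrev 0 * (D.PhiPrev 0)ᵀ * D.S 0) *ᵥ D.residual x0 uLast z 0
        = D.initReactive *ᵥ D.initResidual x0 uLast z := by
      rw [PhiPrev, transpose_one, Matrix.mul_one]; rfl
    rw [output, zero_add, Finset.sum_range_one, Finset.sum_range_one, hL, hg, add_zero, Keff_eq,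
      Finset.Icc_eq_empty (by omega), Finset.sum_empty, add_zero]
  | succ N ih =>
    have h1 : D.output x0 uLast z (N + 1) = D.output x0 uLast z N
        + (D.GPrev (N + 1) * (D.PhiPrev (N + 1))ᵀ * D.S (N + 1))
          *ᵥ (z (N + 1) - D.H (N + 1) *ᵥ D.prior x0 uLast z (N + 1)) := by
      rw [output, output, Finset.sum_range_succ _ (N + 1), add_assoc]; rfl
    set g := D.GPrev (N + 1) * (D.PhiPrev (N + 1))ᵀ * D.S (N + 1) with hg
    have h2 : ∑ k ∈ Finset.range (N + 1), D.Lam (N + 1) k *ᵥ z k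
        = ∑ k ∈ Finset.range (N + 1), D.Lam N k *ᵥ z k
          - (g * D.H (N + 1)) *ᵥ ∑ k ∈ Finset.range (N + 1), D.priorCoeff (N + 1) k *ᵥ z k := by
      rw [mulVec_sum, ← Finset.sum_sub_distrib]
      refine Finset.sum_congr rfl fun k hk => ?_
      rw [Lam_succ (Nat.lt_succ_iff.1 (Finset.mem_range.1 hk)), sub_mulVec, mulVec_mulVec]
    have h3 : D.Keff (N + 1) *ᵥ D.initResidual x0 uLast z = D.Keff N *ᵥ D.initResidual x0 uLast z
        + (g * D.H (N + 1)) *ᵥ (prodIco D.step 0 (N + 1) *ᵥ D.initResidual x0 uLast z) := by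
      rw [Keff_succ, mulVec_mulVec, add_mulVec]
    rw [h1, ih, Finset.sum_range_succ _ (N + 1), Lam_self, h2, h3, prior_eq hH, mulVec_sub,
      mulVec_mulVec, mulVec_add, mulVec_neg, ← hg]
    abel

/-- The observed-control output is the first control of every minimizer. -/
theorem IsOptimal.eq_output (hR : ∀ k, (D.R k).PosDef) (hRt : D.Rt.PosDef) {N : ℕ}
    {u : ℕ → Fin m → ℝ} (hu : D.IsOptimal x0 uLast z N u) : u 0 = D.output x0 uLast z N := by
  rw [← smoothCtrl_zero]
  exact hu.zero_eq hR hRt (isOptimal_smoothCtrl hR hRt N)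

end LQMPC

/-! ### Infinite horizon: limits of minimizers and of gains. -/

lemma exists_tendsto_of_mulVec {ι κ : Type} [Fintype κ] [DecidableEq κ] {M : ℕ → Matrix ι κ ℝ}
    (h : ∀ v : κ → ℝ, ∃ l, Tendsto (fun N => M N *ᵥ v) atTop (𝓝 l)) :
    ∃ L, Tendsto M atTop (𝓝 L) := by
  choose l hl using h
  refine ⟨Matrix.of fun i j => l (Pi.single j 1) i, ?_⟩
  refine tendsto_pi_nhds.2 fun i => tendsto_pi_nhds.2 fun j => ?_
  have h1 := tendsto_pi_nhds.1 (hl (Pi.single j 1)) i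
  simpa using h1

lemma tendsto_mulVec {ι κ : Type} [Fintype κ] {M : ℕ → Matrix ι κ ℝ} {L : Matrix ι κ ℝ}
    (h : Tendsto M atTop (𝓝 L)) (v : κ → ℝ) :
    Tendsto (fun N => M N *ᵥ v) atTop (𝓝 (L *ᵥ v)) := by
  have : Continuous fun A : Matrix ι κ ℝ => A *ᵥ v := by fun_prop
  exact (this.tendsto L).comp h

namespace LQMPC
variable {n m : ℕ} {p : ℕ → ℕ} {D : LQMPC n m p} {x0 : Fin n → ℝ} {uLast : Fin m → ℝ}
  {z : (k : ℕ) → MeasIdx n m p k → ℝ}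

lemma continuous_plantState (A : ℕ → Matrix (Fin n) (Fin n) ℝ) (B : ℕ → Matrix (Fin n) (Fin m) ℝ)
    (x0 : Fin n → ℝ) (k : ℕ) : Continuous fun u => plantState A B x0 u k := by
  induction k with
  | zero => exact continuous_const
  | succ k ih =>
    simp only [plantState]
    exact (continuous_const.matrix_mulVec ih).add
      (continuous_const.matrix_mulVec (continuous_apply k))

lemma continuous_stage (k : ℕ) : Continuous fun u => D.stage x0 uLast z u k := by
  have h1 : Continuous fun u : ℕ → Fin m → ℝ => prevCtrl uLast u k := by
    cases k with
    | zero => exact continuous_const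
    | succ k => exact continuous_apply k
  have h2 : Continuous fun u : ℕ → Fin m → ℝ =>
      Sum.elim (plantState D.A D.B x0 u k) (u k) := by
    refine continuous_pi fun i => ?_
    cases i with
    | inl i => exact (continuous_apply i).comp (continuous_plantState D.A D.B x0 k)
    | inr i => exact (continuous_apply i).comp (continuous_apply k)
  exact ((continuous_quad _).comp (continuous_const.sub (continuous_const.matrix_mulVec h2))).add
    ((continuous_quad _).comp ((continuous_apply k).sub h1))

lemma cost_mono (hR : ∀ k, (D.R k).PosDef) (hRt : D.Rt.PosDef) (u : ℕ → Fin m → ℝ) :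
    Monotone fun N => D.cost x0 uLast z N u := fun _ _ h =>
  Finset.sum_le_sum_of_subset_of_nonneg (Finset.range_mono (Nat.succ_le_succ h))
    fun k _ _ => stage_nonneg hR hRt u k

lemma cost_le_tsum (hR : ∀ k, (D.R k).PosDef) (hRt : D.Rt.PosDef) {u : ℕ → Fin m → ℝ}
    (hu : Summable (D.stage x0 uLast z u)) (N : ℕ) :
    D.cost x0 uLast z N u ≤ ∑' k, D.stage x0 uLast z u k :=
  hu.sum_le_tsum _ fun k _ => stage_nonneg hR hRt u k

/-- If some control has finite cost, the finite-horizon minimizers converge to a minimizer of the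
infinite-horizon problem. -/
theorem exists_isOptimalInf (hR : ∀ k, (D.R k).PosDef) (hRt : D.Rt.PosDef)
    (hfin : ∃ w, Summable (D.stage x0 uLast z w)) :
    ∃ u, D.IsOptimalInf x0 uLast z u ∧
      Tendsto (fun N => D.output x0 uLast z N) atTop (𝓝 (u 0)) := by
  set U : ℕ → ℕ → Fin m → ℝ := fun N => D.smoothCtrl x0 uLast z N with hU
  have hopt : ∀ N, D.IsOptimal x0 uLast z N (U N) := isOptimal_smoothCtrl hR hRt
  set V : ℕ → ℝ := fun N => D.cost x0 uLast z N (U N) with hV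
  have hVle : ∀ N w, Summable (D.stage x0 uLast z w) → V N ≤ ∑' k, D.stage x0 uLast z w k :=
    fun N w hw => (hopt N w).trans (cost_le_tsum hR hRt hw N)
  have hmono : Monotone V := fun N M h =>
    (hopt N (U M)).trans (cost_mono hR hRt (U M) h)
  have hbdd : BddAbove (Set.range V) := by
    obtain ⟨w, hw⟩ := hfin
    exact ⟨_, by rintro _ ⟨N, rfl⟩; exact hVle N w hw⟩
  have hlim := tendsto_atTop_ciSup hmono hbdd
  set L := ⨆ N, V N
  have hVL : ∀ N, V N ≤ L := fun N => le_ciSup hbdd N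
  obtain ⟨c, hc, hcle⟩ := exists_sq_norm_le_quad hRt
  set inc : ℕ → ℕ → Fin m → ℝ := fun k N => U N k - prevCtrl uLast (U N) k with hinc
  -- The minimizer for `M` competes at the shorter horizon `N` with cost at most `L`, so strong
  -- convexity bounds its distance from the minimizer for `N`.
  have hgap : ∀ k N M, k ≤ N → N ≤ M → ‖inc k N - inc k M‖ ^ 2 ≤ c * (2 * (L - V N)) := by
    intro k N M hk hNM
    have h1 := (hopt N).sum_quad_le hR (U M)
    have h2 := Finset.single_le_sum (f := fun k => quad D.Rt (inc k N - inc k M))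
      (fun k _ => quad_nonneg hRt.posSemidef _) (Finset.mem_range.2 (Nat.lt_succ_of_le hk))
    have h3 : D.cost x0 uLast z N (U M) ≤ L := (cost_mono hR hRt (U M) hNM).trans (hVL M)
    have h4 : quad D.Rt (inc k N - inc k M) ≤ 2 * (L - V N) := by
      refine h2.trans (h1.trans ?_)
      simp only [hV]; linarith
    exact (hcle _).trans (by gcongr)
  have hcauchy : ∀ k, CauchySeq (inc k) := by
    intro k
    refine Metric.cauchySeq_iff'.2 fun ε hε => ?_
    -- Chosen so that `c * (2 * (L - V N)) < ε ^ 2`.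
    have h1 : L - ε ^ 2 / (2 * c) < L := by
      have : 0 < ε ^ 2 / (2 * c) := by positivity
      linarith
    obtain ⟨N, hN1, hN2⟩ := ((hlim.eventually_const_lt h1).and (eventually_ge_atTop k)).exists
    refine ⟨N, fun M hM => ?_⟩
    rw [dist_comm, dist_eq_norm]
    refine lt_of_pow_lt_pow_left₀ 2 hε.le ((hgap k N M hN2 hM).trans_lt ?_)
    have h2 : L - V N < ε ^ 2 / (2 * c) := by linarith
    rw [lt_div_iff₀ (by positivity)] at h2
    linarith
  -- Only increments are known to converge; the controls are recovered by summing them from `uLast`.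
  have hconv : ∀ k, ∃ l, Tendsto (fun N => U N k) atTop (𝓝 l) := by
    intro k
    induction k with
    | zero =>
      obtain ⟨l, hl⟩ := cauchySeq_tendsto_of_complete (hcauchy 0)
      exact ⟨l + uLast, (hl.add_const uLast).congr fun N => sub_add_cancel _ _⟩
    | succ k ih =>
      obtain ⟨l, hl⟩ := cauchySeq_tendsto_of_complete (hcauchy (k + 1))
      obtain ⟨l', hl'⟩ := ih
      exact ⟨l + l', (hl.add hl').congr fun N => sub_add_cancel _ _⟩
  choose u hu using hconv
  have hUu : Tendsto U atTop (𝓝 u) := tendsto_pi_nhds.2 hu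
  -- A fixed finite-horizon cost is continuous, so the bound `L` passes to the limit before the
  -- horizon grows.
  have hcost : ∀ N, D.cost x0 uLast z N u ≤ L := by
    intro N
    have h1 : Continuous fun v => D.cost x0 uLast z N v :=
      continuous_finsetSum _ fun k _ => continuous_stage k
    refine le_of_tendsto ((h1.tendsto u).comp hUu) ?_
    filter_upwards [eventually_ge_atTop N] with M hM
    exact (cost_mono hR hRt (U M) hM).trans (hVL M)
  have hpartial : ∀ N, ∑ k ∈ Finset.range N, D.stage x0 uLast z u k ≤ L := fun N =>
    (Finset.sum_le_sum_of_subset_of_nonneg (Finset.range_mono N.le_succ)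
      fun k _ _ => stage_nonneg hR hRt u k).trans (hcost N)
  refine ⟨u, ⟨summable_of_sum_range_le (stage_nonneg hR hRt u) hpartial, fun w hw => ?_⟩, ?_⟩
  · exact (Real.tsum_le_of_sum_range_le (stage_nonneg hR hRt u) hpartial).trans
      (ciSup_le fun N => hVle N w hw)
  · exact (hu 0).congr fun N => smoothCtrl_zero N

lemma IsOptimalInf.zero_eq (hR : ∀ k, (D.R k).PosDef) (hRt : D.Rt.PosDef) {u v : ℕ → Fin m → ℝ}
    (hu : D.IsOptimalInf x0 uLast z u) (hv : D.IsOptimalInf x0 uLast z v) : u 0 = v 0 := by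
  have hle := fun k => stage_midCtrl_le (x0 := x0) (uLast := uLast) (z := z) hR u v k
  have hq := fun k => quad_nonneg hRt.posSemidef
    ((u k - prevCtrl uLast u k) - (v k - prevCtrl uLast v k))
  have hsum := (hu.1.add hv.1).div_const 2
  have hmid : Summable (D.stage x0 uLast z (midCtrl u v)) :=
    Summable.of_nonneg_of_le (stage_nonneg hR hRt _)
      (fun k => by have := hle k; have := hq k; linarith) hsum
  -- The convexity gaps are nonnegative and, by optimality of `u` and `v`, sum to at most zero;
  -- hence the gap at time `0` vanishes.
  have h1 := (hsum.sub hmid).le_tsum 0 fun k _ => by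
    have := hle k; have := hq k; linarith
  rw [hsum.tsum_sub hmid, tsum_div_const, hu.1.tsum_add hv.1] at h1
  have h2 := hu.2 _ hmid
  have h3 := hv.2 _ hmid
  have h4 := hle 0
  have h5 : (u 0 - prevCtrl uLast u 0) - (v 0 - prevCtrl uLast v 0) = u 0 - v 0 :=
    sub_sub_sub_cancel_right _ _ _
  rw [h5] at h4
  by_contra hne
  have := quad_pos hRt (sub_ne_zero.2 hne)
  linarith

variable (D) in
/-- Every problem with finitely many nonzero targets admits a control of finite cost. -/
def FiniteCost : Prop :=
  ∀ (x0 : Fin n → ℝ) (uLast : Fin m → ℝ) (z : (k : ℕ) → MeasIdx n m p k → ℝ) (T : ℕ),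
    (∀ k, T ≤ k → z k = 0) → ∃ w, Summable (D.stage x0 uLast z w)

/-- Output for the data whose first residual vanishes. -/
lemma output_eq_of_initResidual_eq_zero
    (hH : D.H 0 = (1 : Matrix (AugIdx n m) (AugIdx n m) ℝ)) {N k : ℕ} (hk : k ≤ N)
    (e : MeasIdx n m p k → ℝ) :
    D.output (initTarget (Pi.single k e : (k : ℕ) → MeasIdx n m p k → ℝ) ∘ Sum.inl)
        (initTarget (Pi.single k e : (k : ℕ) → MeasIdx n m p k → ℝ) ∘ Sum.inr) (Pi.single k e) N
      = initTarget (Pi.single k e : (k : ℕ) → MeasIdx n m p k → ℝ) ∘ Sum.inr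
        + D.Lam N k *ᵥ e := by
  have h0 := initResidual_eq (x0 := initTarget (Pi.single k e) ∘ Sum.inl)
    (uLast := initTarget (Pi.single k e) ∘ Sum.inr) (z := Pi.single k e) hH
  rw [Sum.elim_comp_inl_inr, sub_self] at h0
  rw [output_eq hH]
  have h1 : D.Keff N *ᵥ D.initResidual (initTarget (Pi.single k e) ∘ Sum.inl)
    (initTarget (Pi.single k e) ∘ Sum.inr) (Pi.single k e) = 0 := by rw [h0, mulVec_zero]
  have h2 : ∑ j ∈ Finset.range (N + 1), D.Lam N j *ᵥ (Pi.single k e : (k : ℕ) → MeasIdx n m p k → ℝ) j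
      = D.Lam N k *ᵥ e := by
    rw [Finset.sum_eq_single k, Pi.single_eq_same]
    · intro j _ hj
      rw [Pi.single_eq_of_ne hj, mulVec_zero]
    · intro h; exact absurd (Finset.mem_range.2 (Nat.lt_succ_of_le hk)) h
  rw [h2]
  exact congrArg (fun v => v + D.Lam N k *ᵥ e) ((congrArg (fun v => _ + v) h1).trans (add_zero _))

lemma output_zero (hH : D.H 0 = (1 : Matrix (AugIdx n m) (AugIdx n m) ℝ)) (N : ℕ) :
    D.output x0 uLast 0 N = uLast - D.Keff N *ᵥ Sum.elim x0 uLast := by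
  have h0 : D.initResidual x0 uLast 0 = -Sum.elim x0 uLast :=
    (initResidual_eq hH).trans (zero_sub _)
  have h1 : D.Keff N *ᵥ D.initResidual x0 uLast 0 = -(D.Keff N *ᵥ Sum.elim x0 uLast) := by
    rw [h0, mulVec_neg]
  rw [output_eq hH, Finset.sum_eq_zero fun k _ => by rw [Pi.zero_apply, mulVec_zero], add_zero,
    sub_eq_add_neg]
  exact congrArg (fun v => uLast + v) h1

/-- With zero targets the output is `uLast` minus the gain applied to the initial data, so
convergence of the outputs is convergence of the gain on each vector. -/
theorem exists_tendsto_Keff (hR : ∀ k, (D.R k).PosDef) (hRt : D.Rt.PosDef)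
    (hH : D.H 0 = (1 : Matrix (AugIdx n m) (AugIdx n m) ℝ)) (hfin : D.FiniteCost) :
    ∃ L, Tendsto (fun N => D.Keff N) atTop (𝓝 L) := by
  refine exists_tendsto_of_mulVec fun v => ?_
  obtain ⟨u, -, hu⟩ := exists_isOptimalInf hR hRt
    (hfin (v ∘ Sum.inl) (v ∘ Sum.inr) 0 0 fun _ _ => rfl)
  refine ⟨v ∘ Sum.inr - u 0, (hu.const_sub (v ∘ Sum.inr)).congr fun N => ?_⟩
  rw [output_zero hH, Sum.elim_comp_inl_inr, sub_sub_cancel]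

theorem exists_tendsto_Lam (hR : ∀ k, (D.R k).PosDef) (hRt : D.Rt.PosDef)
    (hH : D.H 0 = (1 : Matrix (AugIdx n m) (AugIdx n m) ℝ)) (hfin : D.FiniteCost) (k : ℕ) :
    ∃ L, Tendsto (fun N => D.Lam N k) atTop (𝓝 L) := by
  refine exists_tendsto_of_mulVec fun e => ?_
  -- Starting at `(x_0, u_{-1}) = z_0` kills the reactive term, and a single nonzero target isolates
  -- one gain.
  set a := initTarget (Pi.single k e : (k : ℕ) → MeasIdx n m p k → ℝ) with ha
  obtain ⟨u, -, hu⟩ := exists_isOptimalInf hR hRt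
    (hfin (a ∘ Sum.inl) (a ∘ Sum.inr) (Pi.single k e) (k + 1)
      fun j hj => by rw [Pi.single_eq_of_ne (Nat.ne_of_gt hj)])
  refine ⟨u 0 - a ∘ Sum.inr, (hu.sub_const (a ∘ Sum.inr)).congr' ?_⟩
  filter_upwards [eventually_ge_atTop k] with N hN
  rw [ha, output_eq_of_initResidual_eq_zero hH hN, add_sub_cancel_left]

/-- The limits of the gains give the first control of every infinite-horizon minimizer. -/
theorem IsOptimalInf.eq_limit (hR : ∀ k, (D.R k).PosDef) (hRt : D.Rt.PosDef)
    (hH : D.H 0 = (1 : Matrix (AugIdx n m) (AugIdx n m) ℝ)) (hfin : D.FiniteCost)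
    {Kinf : Matrix (Fin m) (AugIdx n m) ℝ}
    (hK : Tendsto (fun N => D.Keff N) atTop (𝓝 Kinf))
    {Laminf : (k : ℕ) → Matrix (Fin m) (MeasIdx n m p k) ℝ}
    (hL : ∀ k, Tendsto (fun N => D.Lam N k) atTop (𝓝 (Laminf k)))
    {T : ℕ} (hz : ∀ k, T ≤ k → z k = 0) {u : ℕ → Fin m → ℝ}
    (hu : D.IsOptimalInf x0 uLast z u) :
    u 0 = uLast + Kinf *ᵥ D.initResidual x0 uLast z
      + ∑ k ∈ Finset.range T, Laminf k *ᵥ z k := by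
  obtain ⟨v, hv, hlim⟩ := exists_isOptimalInf hR hRt (hfin x0 uLast z T hz)
  rw [hu.zero_eq hR hRt hv]
  refine tendsto_nhds_unique hlim ?_
  have h1 := ((tendsto_mulVec hK (D.initResidual x0 uLast z)).const_add uLast).add
    (tendsto_finsetSum (Finset.range T) fun k _ => tendsto_mulVec (hL k) (z k))
  refine h1.congr' ?_
  filter_upwards [eventually_ge_atTop T] with N hN
  rw [output_eq hH]
  refine congrArg₂ _ rfl (Finset.sum_subset (Finset.range_mono (by omega)) fun k _ hk => ?_)
  rw [hz k (by simpa using hk), mulVec_zero]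

end LQMPC

/-! ### Finite cost from stabilizability. -/

section TimeInvariant
variable {n m q : ℕ} {A : Matrix (Fin n) (Fin n) ℝ} {B : Matrix (Fin n) (Fin m) ℝ}
  {R0 : Matrix (AugIdx n m) (AugIdx n m) ℝ} {H : Matrix (Fin q) (AugIdx n m) ℝ}
  {R : Matrix (Fin q) (Fin q) ℝ} {Rt : Matrix (Fin m) (Fin m) ℝ}
  {x0 : Fin n → ℝ} {uLast : Fin m → ℝ}

lemma ltiData_stage_succ {z : (k : ℕ) → MeasIdx n m (fun _ => q) k → ℝ} {k : ℕ}
    (hz : z (k + 1) = 0) (u : ℕ → Fin m → ℝ) :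
    (ltiData A B R0 H R Rt).stage x0 uLast z u (k + 1)
      = quad R⁻¹ (H *ᵥ Sum.elim (plantState (fun _ => A) (fun _ => B) x0 u (k + 1)) (u (k + 1)))
        + quad Rt (u (k + 1) - u k) := by
  rw [LQMPC.stage, hz, zero_sub, quad_neg]
  rfl

lemma ltiData_R_posDef (hR0 : R0.PosDef) (hR : R.PosDef) (k : ℕ) :
    ((ltiData A B R0 H R Rt).R k).PosDef := by
  cases k with
  | zero => exact hR0
  | succ k => exact hR

/-- The stabilizing feedback `u_k = -F x_k` makes tracking and rate terms quadratic forms along a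
Schur orbit once the targets have vanished. -/
lemma ltiData_finiteCost (hAB : Stabilizable A B) : (ltiData A B R0 H R Rt).FiniteCost := by
  intro x0 uLast z T hz
  obtain ⟨F, hF⟩ := hAB
  set C := A - B * F with hC
  set w : ℕ → Fin m → ℝ := fun k => -(F *ᵥ ((C ^ k) *ᵥ x0)) with hw
  have hx : ∀ k, plantState (fun _ => A) (fun _ => B) x0 w k = (C ^ k) *ᵥ x0 := by
    intro k
    induction k with
    | zero => simp [plantState]
    | succ k ih =>
      rw [plantState, ih, hw, pow_succ', ← mulVec_mulVec x0 C, hC, sub_mulVec, mulVec_neg,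
        ← mulVec_mulVec _ B F, ← sub_eq_add_neg]
  -- Dropping `T + 1` stages removes both the nonzero targets and the exceptional stage `0`.
  refine ⟨w, (summable_nat_add_iff (T + 1)).1 ?_⟩
  set E : Matrix (AugIdx n m) (Fin n) ℝ := fromRows 1 (-F) with hE
  have hstage : ∀ j k, j = k + T + 1 → (ltiData A B R0 H R Rt).stage x0 uLast z w j
      = quad ((H * E)ᵀ * R⁻¹ * (H * E)) ((C ^ j) *ᵥ x0)
        + quad ((F * (C - 1))ᵀ * Rt * (F * (C - 1))) ((C ^ (k + T)) *ᵥ x0) := by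
    rintro _ k rfl
    have h1 := ltiData_stage_succ (A := A) (B := B) (R0 := R0) (H := H) (R := R) (Rt := Rt)
      (x0 := x0) (uLast := uLast) (z := z) (k := k + T) (hz _ (by omega)) w
    have h2 : Sum.elim (plantState (fun _ => A) (fun _ => B) x0 w (k + T + 1)) (w (k + T + 1))
        = E *ᵥ ((C ^ (k + T + 1)) *ᵥ x0) := by
      rw [hx, hE, fromRows_mulVec, one_mulVec, neg_mulVec]
    have h3 : w (k + T + 1) - w (k + T) = -((F * (C - 1)) *ᵥ ((C ^ (k + T)) *ᵥ x0)) := by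
      simp only [hw, pow_succ', ← mulVec_mulVec, sub_mulVec, one_mulVec, mulVec_sub]
      abel
    rw [h2, h3, quad_neg, mulVec_mulVec _ H E, quad_mulVec R⁻¹, quad_mulVec Rt (F * (C - 1))] at h1
    exact h1
  have h1 := (summable_nat_add_iff (T + 1)).2
    (hF.summable_quad ((H * E)ᵀ * R⁻¹ * (H * E)) x0)
  have h2 := (summable_nat_add_iff T).2
    (hF.summable_quad ((F * (C - 1))ᵀ * Rt * (F * (C - 1))) x0)
  exact (h1.add h2).congr fun k => (hstage (k + (T + 1)) k (add_assoc k T 1).symm).symm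

end TimeInvariant

/-! ### The linear-quadratic regulator. -/

section Regulator
variable {n m q : ℕ} {A : Matrix (Fin n) (Fin n) ℝ} {B : Matrix (Fin n) (Fin m) ℝ}
  {Q : Matrix (Fin n) (Fin n) ℝ} {M : Matrix (Fin n) (Fin m) ℝ} {Rl Rt : Matrix (Fin m) (Fin m) ℝ}
  {x0 : Fin n → ℝ} {uLast : Fin m → ℝ}

lemma plantState_const_succ (x0 : Fin n → ℝ) (u : ℕ → Fin m → ℝ) (k : ℕ) :
    plantState (fun _ => A) (fun _ => B) x0 u (k + 1)
      = plantState (fun _ => A) (fun _ => B) (A *ᵥ x0 + B *ᵥ u 0) (fun j => u (j + 1)) k := by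
  induction k with
  | zero => rfl
  | succ k ih => rw [plantState, ih]; rfl

lemma lqrStage_succ (u : ℕ → Fin m → ℝ) (k : ℕ) :
    lqrStage A B Q M Rl Rt x0 uLast u (k + 1)
      = lqrStage A B Q M Rl Rt (A *ᵥ x0 + B *ᵥ u 0) (u 0) (fun j => u (j + 1)) k := by
  have h : prevCtrl (u 0) (fun j => u (j + 1)) k = prevCtrl uLast u (k + 1) := by
    cases k <;> rfl
  simp only [lqrStage, plantState_const_succ, h]

/-- The principle of optimality. -/
lemma IsLQROptimal.tail {u : ℕ → Fin m → ℝ} (hu : IsLQROptimal A B Q M Rl Rt x0 uLast u) :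
    IsLQROptimal A B Q M Rl Rt (A *ᵥ x0 + B *ᵥ u 0) (u 0) (fun j => u (j + 1)) := by
  have hs := (summable_nat_add_iff 1).2 hu.1
  simp only [lqrStage_succ] at hs
  refine ⟨hs, fun w hw => ?_⟩
  -- A competitor for the tail problem is prefixed by `u 0`, which leaves stage `0` unchanged.
  set w' : ℕ → Fin m → ℝ := fun k => Nat.casesOn k (u 0) w with hw'
  have hs' : ∀ k, lqrStage A B Q M Rl Rt x0 uLast w' (k + 1)
      = lqrStage A B Q M Rl Rt (A *ᵥ x0 + B *ᵥ u 0) (u 0) w k := lqrStage_succ w'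
  have h0 : lqrStage A B Q M Rl Rt x0 uLast w' 0 = lqrStage A B Q M Rl Rt x0 uLast u 0 := rfl
  have hsum : Summable (lqrStage A B Q M Rl Rt x0 uLast w') :=
    (summable_nat_add_iff 1).1 (hw.congr fun k => (hs' k).symm)
  have h1 := hu.2 w' hsum
  rw [hu.1.tsum_eq_zero_add, hsum.tsum_eq_zero_add, h0] at h1
  simp only [hs', lqrStage_succ u] at h1
  linarith

/-- The state feedback `u_k = u_{k-1} - K (x_k, u_{k-1})`. -/
def IsFeedback (A : Matrix (Fin n) (Fin n) ℝ) (B : Matrix (Fin n) (Fin m) ℝ)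
    (K : Matrix (Fin m) (AugIdx n m) ℝ) (x0 : Fin n → ℝ) (uLast : Fin m → ℝ)
    (u : ℕ → Fin m → ℝ) : Prop :=
  ∀ k, u k = prevCtrl uLast u k
    - K *ᵥ Sum.elim (plantState (fun _ => A) (fun _ => B) x0 u k) (prevCtrl uLast u k)

lemma IsFeedback.orbit {K : Matrix (Fin m) (AugIdx n m) ℝ} {u : ℕ → Fin m → ℝ}
    (hu : IsFeedback A B K x0 uLast u) (k : ℕ) :
    Sum.elim (plantState (fun _ => A) (fun _ => B) x0 u k) (prevCtrl uLast u k)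
      = ((augPhi A B * (1 - (ctrlSel n m)ᵀ * K)) ^ k) *ᵥ Sum.elim x0 uLast := by
  induction k with
  | zero => rw [pow_zero, one_mulVec]; rfl
  | succ k ih =>
    have h1 : (1 - (ctrlSel n m)ᵀ * K)
        *ᵥ Sum.elim (plantState (fun _ => A) (fun _ => B) x0 u k) (prevCtrl uLast u k)
        = Sum.elim (plantState (fun _ => A) (fun _ => B) x0 u k) (u k) := by
      rw [sub_mulVec, one_mulVec, ← mulVec_mulVec, ctrlSel_transpose_mulVec, hu k]
      ext (i | i) <;> simp
    rw [pow_succ', ← mulVec_mulVec, ← ih, ← mulVec_mulVec, h1, augPhi_mulVec]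
    rfl

lemma IsFeedback.unique {K : Matrix (Fin m) (AugIdx n m) ℝ} {u v : ℕ → Fin m → ℝ}
    (hu : IsFeedback A B K x0 uLast u) (hv : IsFeedback A B K x0 uLast v) : u = v := by
  funext k
  have h := (hu.orbit (k + 1)).trans (hv.orbit (k + 1)).symm
  exact congrArg (fun f => f ∘ Sum.inr) h

lemma exists_isFeedback (A : Matrix (Fin n) (Fin n) ℝ) (B : Matrix (Fin n) (Fin m) ℝ)
    (K : Matrix (Fin m) (AugIdx n m) ℝ) (x0 : Fin n → ℝ) (uLast : Fin m → ℝ) :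
    ∃ u, IsFeedback A B K x0 uLast u := by
  set F := augPhi A B * (1 - (ctrlSel n m)ᵀ * K)
  set s : ℕ → AugIdx n m → ℝ := fun k => (F ^ k) *ᵥ Sum.elim x0 uLast with hs
  set u : ℕ → Fin m → ℝ := fun k => s k ∘ Sum.inr - K *ᵥ s k with hu
  have key : ∀ k, Sum.elim (plantState (fun _ => A) (fun _ => B) x0 u k) (prevCtrl uLast u k)
      = s k := by
    intro k
    induction k with
    | zero => simp only [hs, pow_zero, one_mulVec]; rfl
    | succ k ih =>
      have h1 : (1 - (ctrlSel n m)ᵀ * K) *ᵥ s k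
          = Sum.elim (plantState (fun _ => A) (fun _ => B) x0 u k) (u k) := by
        have h3 : u k = s k ∘ Sum.inr - K *ᵥ s k := rfl
        rw [sub_mulVec, one_mulVec, ← mulVec_mulVec, ctrlSel_transpose_mulVec, h3, ← ih]
        ext (i | i) <;> simp
      have h2 : s (k + 1) = augPhi A B *ᵥ ((1 - (ctrlSel n m)ᵀ * K) *ᵥ s k) := by
        simp only [hs, pow_succ', mulVec_mulVec, F, Matrix.mul_assoc]
      rw [h2, h1, augPhi_mulVec]
      rfl
  refine ⟨u, fun k => ?_⟩
  rw [key k]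
  have h := congrArg (fun f => f ∘ Sum.inr) (key k)
  simp only [Sum.elim_comp_inr] at h
  rw [h]

/-- The first-control law holds from every initial pair, and tails of minimizers are minimizers, so
it holds at every time. -/
lemma IsLQROptimal.isFeedback {K : Matrix (Fin m) (AugIdx n m) ℝ}
    (hK : ∀ (x0 : Fin n → ℝ) (uLast : Fin m → ℝ) (u : ℕ → Fin m → ℝ),
      IsLQROptimal A B Q M Rl Rt x0 uLast u → u 0 = uLast - K *ᵥ Sum.elim x0 uLast)
    {u : ℕ → Fin m → ℝ} (hu : IsLQROptimal A B Q M Rl Rt x0 uLast u) :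
    IsFeedback A B K x0 uLast u := by
  intro k
  induction k generalizing x0 uLast u with
  | zero => exact hK x0 uLast u hu
  | succ k ih =>
    have h := ih hu.tail
    have h2 : prevCtrl (u 0) (fun j => u (j + 1)) k = prevCtrl uLast u (k + 1) := by
      cases k <;> rfl
    rw [h2, ← plantState_const_succ] at h
    exact h

variable {R0 : Matrix (AugIdx n m) (AugIdx n m) ℝ} {H : Matrix (Fin q) (AugIdx n m) ℝ}
  {R : Matrix (Fin q) (Fin q) ℝ} {Q0 : Matrix (Fin n) (Fin n) ℝ}

lemma stage_eq_lqrStage_add (h0 : R0⁻¹ = fromBlocks Q0 M Mᵀ Rl)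
    (h1 : Hᵀ * R⁻¹ * H = fromBlocks Q M Mᵀ Rl) (u : ℕ → Fin m → ℝ) (k : ℕ) :
    (ltiData A B R0 H R Rt).stage x0 uLast 0 u k = lqrStage A B Q M Rl Rt x0 uLast u k
      + if k = 0 then quad Q0 x0 - quad Q x0 else 0 := by
  cases k with
  | zero =>
    have h2 : (ltiData A B R0 H R Rt).stage x0 uLast 0 u 0
        = quad R0⁻¹ (0 - (1 : Matrix (AugIdx n m) (AugIdx n m) ℝ) *ᵥ Sum.elim x0 (u 0))
          + quad Rt (u 0 - uLast) := rfl
    have h3 : lqrStage A B Q M Rl Rt x0 uLast u 0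
        = quad Q x0 + quad Rl (u 0) + 2 * (x0 ⬝ᵥ (M *ᵥ u 0)) + quad Rt (u 0 - uLast) := rfl
    rw [h2, h3, one_mulVec, zero_sub, quad_neg, h0, quad_fromBlocks, if_pos rfl]
    ring
  | succ k =>
    rw [ltiData_stage_succ rfl, quad_mulVec, h1, quad_fromBlocks, if_neg k.succ_ne_zero, add_zero]
    rfl

/-- The costs differ only at time `0`, by the forms `Q0` and `Q` at the fixed state `x0`, a constant
independent of the control. -/
lemma isOptimalInf_iff_isLQROptimal (h0 : R0⁻¹ = fromBlocks Q0 M Mᵀ Rl)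
    (h1 : Hᵀ * R⁻¹ * H = fromBlocks Q M Mᵀ Rl) (u : ℕ → Fin m → ℝ) :
    (ltiData A B R0 H R Rt).IsOptimalInf x0 uLast 0 u
      ↔ IsLQROptimal A B Q M Rl Rt x0 uLast u := by
  have hc := hasSum_ite_eq (0 : ℕ) (quad Q0 x0 - quad Q x0)
  have hst := fun u : ℕ → Fin m → ℝ => funext
    (stage_eq_lqrStage_add (A := A) (B := B) (Rt := Rt) (x0 := x0) (uLast := uLast) h0 h1 u)
  have hs : ∀ u : ℕ → Fin m → ℝ, Summable ((ltiData A B R0 H R Rt).stage x0 uLast 0 u)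
      ↔ Summable (lqrStage A B Q M Rl Rt x0 uLast u) := fun u => by
    rw [hst u]
    exact ⟨fun h => by simpa using h.sub hc.summable, fun h => h.add hc.summable⟩
  have ht : ∀ u : ℕ → Fin m → ℝ, Summable (lqrStage A B Q M Rl Rt x0 uLast u) →
      ∑' k, (ltiData A B R0 H R Rt).stage x0 uLast 0 u k
        = ∑' k, lqrStage A B Q M Rl Rt x0 uLast u k + (quad Q0 x0 - quad Q x0) := fun u h => by
    rw [hst u, h.tsum_add hc.summable, hc.tsum_eq]
  constructor
  · rintro ⟨hu, hopt⟩
    refine ⟨(hs u).1 hu, fun w hw => ?_⟩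
    have := hopt w ((hs w).2 hw)
    rw [ht u ((hs u).1 hu), ht w hw] at this
    linarith
  · rintro ⟨hu, hopt⟩
    refine ⟨(hs u).2 hu, fun w hw => ?_⟩
    rw [ht u hu, ht w ((hs w).1 hw)]
    linarith [hopt w ((hs w).1 hw)]

/-- Detectability makes every feedback of finite cost asymptotically stable. -/
lemma IsFeedback.tendsto_zero (hR : R.PosDef) (hRt : Rt.PosDef) (hdet : Detectable (augPhi A B) H)
    {K : Matrix (Fin m) (AugIdx n m) ℝ} {u : ℕ → Fin m → ℝ} (hu : IsFeedback A B K x0 uLast u)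
    (hsum : Summable ((ltiData A B R0 H R Rt).stage x0 uLast 0 u)) :
    Tendsto (fun k => ((augPhi A B * (1 - (ctrlSel n m)ᵀ * K)) ^ k) *ᵥ Sum.elim x0 uLast)
      atTop (𝓝 0) := by
  obtain ⟨L, hL⟩ := hdet
  set D := ltiData A B R0 H R Rt
  -- The shift by one skips the stage with `H_0 = I`, so that every `χ k` is measured by `H`.
  set χ : ℕ → AugIdx n m → ℝ := fun k => D.augState x0 u (k + 1) with hχ
  have hst : Tendsto (fun k => quad R⁻¹ (H *ᵥ χ k) + quad Rt (u (k + 1) - u k)) atTop (𝓝 0) :=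
    ((tendsto_add_atTop_iff_nat 1).2 hsum.tendsto_atTop_zero).congr
      fun k => ltiData_stage_succ rfl u
  have hy : Tendsto (fun k => H *ᵥ χ k) atTop (𝓝 0) :=
    tendsto_zero_of_quad hR.inv (squeeze_zero (fun k => quad_nonneg hR.inv.posSemidef _)
      (fun k => le_add_of_nonneg_right (quad_nonneg hRt.posSemidef _)) hst)
  have hw : Tendsto (fun k => u (k + 1) - u k) atTop (𝓝 0) :=
    tendsto_zero_of_quad hRt (squeeze_zero (fun k => quad_nonneg hRt.posSemidef _)
      (fun k => le_add_of_nonneg_left (quad_nonneg hR.inv.posSemidef _)) hst)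
  -- Output injection: adding and subtracting `L H χ` exposes the Schur matrix, driven by outputs
  -- and increments that tend to zero because the cost is finite.
  have hrec : ∀ k, χ (k + 1) = (augPhi A B - L * H) *ᵥ χ k
      + (L *ᵥ (H *ᵥ χ k) + (ctrlSel n m)ᵀ *ᵥ (u (k + 1 + 1) - u (k + 1))) := by
    intro k
    have h1 : χ (k + 1) = augPhi A B *ᵥ χ k + (ctrlSel n m)ᵀ *ᵥ (u (k + 1 + 1) - u (k + 1)) := by
      have h2 := D.augState_eq x0 uLast u (k + 1 + 1)
      rw [D.augPrior_succ] at h2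
      exact h2
    rw [h1, sub_mulVec, ← mulVec_mulVec]
    abel
  have hd : Tendsto (fun k => L *ᵥ (H *ᵥ χ k)
      + (ctrlSel n m)ᵀ *ᵥ (u (k + 1 + 1) - u (k + 1))) atTop (𝓝 0) := by
    have c1 : Continuous fun v : Fin q → ℝ => L *ᵥ v := by fun_prop
    have c2 : Continuous fun v : Fin m → ℝ => (ctrlSel n m)ᵀ *ᵥ v := by fun_prop
    have := ((c1.tendsto 0).comp hy).add
      ((c2.tendsto 0).comp ((tendsto_add_atTop_iff_nat 1).2 hw))
    rw [mulVec_zero, mulVec_zero, add_zero] at this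
    exact this
  have hχ0 := hL.tendsto_zero hrec hd
  refine (tendsto_add_atTop_iff_nat 2).1 ?_
  have c3 : Continuous fun v : AugIdx n m → ℝ => augPhi A B *ᵥ v := by fun_prop
  have h3 := (c3.tendsto 0).comp hχ0
  rw [mulVec_zero] at h3
  refine h3.congr fun k => ?_
  rw [← hu.orbit (k + 2)]
  exact (D.augPrior_succ x0 uLast u (k + 1)).symm

/-- The gain read off the infinite-horizon problem without targets is the stabilizing LQR gain. -/
theorem isStabilizingLQRGain_of_forall (hR : R.PosDef) (hRt : Rt.PosDef)
    (hdet : Detectable (augPhi A B) H) (h0 : R0⁻¹ = fromBlocks Q0 M Mᵀ Rl)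
    (h1 : Hᵀ * R⁻¹ * H = fromBlocks Q M Mᵀ Rl) {K : Matrix (Fin m) (AugIdx n m) ℝ}
    (hex : ∀ (x0 : Fin n → ℝ) (uLast : Fin m → ℝ),
      ∃ u, (ltiData A B R0 H R Rt).IsOptimalInf x0 uLast 0 u)
    (hK : ∀ (x0 : Fin n → ℝ) (uLast : Fin m → ℝ) (u : ℕ → Fin m → ℝ),
      (ltiData A B R0 H R Rt).IsOptimalInf x0 uLast 0 u →
        u 0 = uLast - K *ᵥ Sum.elim x0 uLast) :
    IsStabilizingLQRGain A B Q M Rl Rt K ∧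
      ∀ K', IsStabilizingLQRGain A B Q M Rl Rt K' → K' = K := by
  have hK' : ∀ (x0 : Fin n → ℝ) (uLast : Fin m → ℝ) (u : ℕ → Fin m → ℝ),
      IsLQROptimal A B Q M Rl Rt x0 uLast u → u 0 = uLast - K *ᵥ Sum.elim x0 uLast :=
    fun x0 uLast u hu => hK x0 uLast u ((isOptimalInf_iff_isLQROptimal h0 h1 u).2 hu)
  refine ⟨⟨fun x0 uLast u hu => ?_, isSchur_of_tendsto fun v => ?_⟩, fun K' hG => ?_⟩
  · obtain ⟨v, hv⟩ := hex x0 uLast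
    have hv' := (isOptimalInf_iff_isLQROptimal h0 h1 v).1 hv
    have hu' : IsFeedback A B K x0 uLast u := hu
    rwa [hu'.unique (hv'.isFeedback hK')]
  · obtain ⟨u, hu⟩ := hex (v ∘ Sum.inl) (v ∘ Sum.inr)
    have hu' := (isOptimalInf_iff_isLQROptimal h0 h1 u).1 hu
    have := (hu'.isFeedback hK').tendsto_zero hR hRt hdet hu.1
    rwa [Sum.elim_comp_inl_inr] at this
  · refine Matrix.ext_of_mulVec_single fun i => ?_
    set v : AugIdx n m → ℝ := Pi.single i 1
    obtain ⟨u, hu⟩ := exists_isFeedback A B K' (v ∘ Sum.inl) (v ∘ Sum.inr)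
    have e1 := hK' _ _ u (hG.1 _ _ u hu)
    have e2 : u 0 = v ∘ Sum.inr - K' *ᵥ Sum.elim (v ∘ Sum.inl) (v ∘ Sum.inr) := hu 0
    rw [e1, Sum.elim_comp_inl_inr] at e2
    exact (sub_right_injective e2).symm

end Regulator
end ObsCtrl
end

/-! ### Assembly of the three statements. -/

open ObsCtrl in
theorem theorem3 (n m : ℕ) :
    -- the factorization of the optimal predictive control, for every horizon length
    (∀ (p : ℕ → ℕ) (D : LQMPC n m p),
      (∀ k, (D.R k).PosDef) → D.Rt.PosDef →
      D.H 0 = (1 : Matrix (AugIdx n m) (AugIdx n m) ℝ) →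
      ∀ (N : ℕ) (x0 : Fin n → ℝ) (uLast : Fin m → ℝ) (z : (k : ℕ) → MeasIdx n m p k → ℝ),
        D.output x0 uLast z N =
            uLast + D.Keff N *ᵥ D.residual x0 uLast z 0
              + ∑ k ∈ Finset.range (N + 1), D.Lam N k *ᵥ z k ∧
          (∃ u, D.IsOptimal x0 uLast z N u) ∧
          (∀ u, D.IsOptimal x0 uLast z N u → u 0 = D.output x0 uLast z N)) ∧
    -- the limits of the gains, for time-invariant data
    (∀ (q : ℕ) (A : Matrix (Fin n) (Fin n) ℝ) (B : Matrix (Fin n) (Fin m) ℝ)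
      (R0 : Matrix (AugIdx n m) (AugIdx n m) ℝ) (H : Matrix (Fin q) (AugIdx n m) ℝ)
      (R : Matrix (Fin q) (Fin q) ℝ) (Rt : Matrix (Fin m) (Fin m) ℝ),
      R0.PosDef → R.PosDef → Rt.PosDef →
      Stabilizable A B → Detectable (augPhi A B) H →
      ∃ (Kinf : Matrix (Fin m) (AugIdx n m) ℝ)
        (Laminf : (k : ℕ) → Matrix (Fin m) (MeasIdx n m (fun _ => q) k) ℝ),
        Tendsto (fun N => (ltiData A B R0 H R Rt).Keff N) atTop (𝓝 Kinf) ∧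
        (∀ k, Tendsto (fun N => (ltiData A B R0 H R Rt).Lam N k) atTop (𝓝 (Laminf k))) ∧
        -- the limits are the optimal gains of the infinite-horizon tracking problem
        (∀ (x0 : Fin n → ℝ) (uLast : Fin m → ℝ)
          (z : (k : ℕ) → MeasIdx n m (fun _ => q) k → ℝ) (T : ℕ), (∀ k, T ≤ k → z k = 0) →
          (∃ u, (ltiData A B R0 H R Rt).IsOptimalInf x0 uLast z u) ∧
          (∀ u, (ltiData A B R0 H R Rt).IsOptimalInf x0 uLast z u →
            u 0 = uLast + Kinf *ᵥ (ltiData A B R0 H R Rt).residual x0 uLast z 0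
              + ∑ k ∈ Finset.range T, Laminf k *ᵥ z k)) ∧
        -- and `Kinf` is the stabilizing LQR gain
        (∀ (Q0 Q : Matrix (Fin n) (Fin n) ℝ) (M : Matrix (Fin n) (Fin m) ℝ)
          (Rl : Matrix (Fin m) (Fin m) ℝ),
          R0⁻¹ = Matrix.fromBlocks Q0 M Mᵀ Rl → Hᵀ * R⁻¹ * H = Matrix.fromBlocks Q M Mᵀ Rl →
          IsStabilizingLQRGain A B Q M Rl Rt Kinf ∧
          ∀ K', IsStabilizingLQRGain A B Q M Rl Rt K' → K' = Kinf)) := by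
  refine ⟨fun p D hR hRt hH N x0 uLast z => ⟨LQMPC.output_eq hH N,
    ⟨_, LQMPC.isOptimal_smoothCtrl hR hRt N⟩, fun u hu => hu.eq_output hR hRt⟩, ?_⟩
  intro q A B R0 H R Rt hR0 hR hRt hAB hdet
  have hRk := ltiData_R_posDef (A := A) (B := B) (H := H) (Rt := Rt) hR0 hR
  have hH : (ltiData A B R0 H R Rt).H 0 = (1 : Matrix (AugIdx n m) (AugIdx n m) ℝ) := rfl
  have hfin : (ltiData A B R0 H R Rt).FiniteCost := ltiData_finiteCost hAB
  obtain ⟨Kinf, hK⟩ := LQMPC.exists_tendsto_Keff hRk hRt hH hfin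
  choose Laminf hL using LQMPC.exists_tendsto_Lam hRk hRt hH hfin
  have hex : ∀ (x0 : Fin n → ℝ) (uLast : Fin m → ℝ)
      (z : (k : ℕ) → MeasIdx n m (fun _ => q) k → ℝ) (T : ℕ), (∀ k, T ≤ k → z k = 0) →
      ∃ u, (ltiData A B R0 H R Rt).IsOptimalInf x0 uLast z u := fun x0 uLast z T hz =>
    (LQMPC.exists_isOptimalInf hRk hRt (hfin x0 uLast z T hz)).imp fun _ h => h.1
  refine ⟨Kinf, Laminf, hK, hL, fun x0 uLast z T hz => ⟨hex x0 uLast z T hz, fun u hu =>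
    hu.eq_limit hRk hRt hH hfin hK hL hz⟩, fun Q0 Q M Rl h0 h1 => ?_⟩
  refine isStabilizingLQRGain_of_forall hR hRt hdet h0 h1
    (fun x0 uLast => hex x0 uLast 0 0 fun _ _ => rfl) fun x0 uLast u hu => ?_
  -- With zero targets `T = 0` leaves no feed-forward sum, and the first residual is `-(x0, uLast)`.
  have h2 := hu.eq_limit hRk hRt hH hfin hK hL (T := 0) fun _ _ => rfl
  rw [h2, Finset.sum_range_zero, add_zero, LQMPC.initResidual_eq hH, sub_eq_add_neg uLast, ← mulVec_neg]
  exact congrArg (fun v => uLast + Kinf *ᵥ v) (zero_sub _)
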